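/- Let $G$ be an amenable locally compact (Hausdorff) group with a fixed left Haar measure $\lambda$; amenable means that there is a left invariant mean on $L^\infty(G)$. Let $\Phi:\mathbb R\to[0,\infty)$ be an $N$-function, that is, a convex even function with $\Phi(0)=0$, $\lim_{x\to0}\Phi(x)/x=0$ and $\lim_{x\to\infty}\Phi(x)/x=\infty$, and let $\Psi(y)=\sup\{x|y|-\Phi(x):x\ge0\}$ be its complementary function. Put $\rho_\Phi(f)=\int_G\Phi(|f|)\,d\lambda$, let $M^\Phi(G)$ be the space of $\lambda$-measurable $f:G\to\mathbb C$ with $\rho_\Phi(af)<\infty$ for all $a>0$, and define $$N_\Phi(f)=\inf\{k>0:\rho_\Phi(f/k)\le1\},\qquad \|g\|_\Psi=\sup\Big\{\int_G|gh|\,d\lambda: h\text{ measurable},\ N_\Phi(h)\le1\Big\};$$ $M^\Psi(G)$ is defined in the same way from $\Psi$. The convolution $(f*g)(x)=\int_G f(y)g(y^{-1}x)\,d\lambda(y)$ is said to exist if $y\mapsto f(y)g(y^{-1}x)$ is integrable for $\lambda$-almost every $x\in G$. Write $\check g(x)=g(x^{-1})$. Let $A_\Phi(G)$ be the set of those $u\in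 C_0(G)$ for which there are sequences $(f_n)$ in $M^\Phi(G)$ and $(g_n)$ in $M^\Psi(G)$ with $\sum_n N_\Phi(f_n)\|g_n\|_\Psi<\infty$ and $u=\sum_n f_n*\check g_n$ pointwise on $G$, with the norm $$\|u\|_{A_\Phi}=\inf\Big\{\sum_{n} N_\Phi(f_n)\|g_n\|_\Psi: u=\sum_{n} f_n*\check g_n\Big\},$$ the infimum being over all such representations. Then the convolution of every two functions in $A_\Phi(G)$ exists if and only if $G$ is compact. In particular, $(A_\Phi(G),\|\cdot\|_{A_\Phi})$ is a Banach algebra under convolution if and only if $G$ is compact. Here "Banach algebra under convolution" means that $A_\Phi(G)$ with $\|\cdot\|_{A_\Phi}$ is a Banach space, that the convolution of any two of its elements exists and belongs to it (as a function defined almost everywhere), that convolution is bilinear and associative on it, and that $\|u*v\|_{A_\Phi}\le C\|u\|_{A_\Phi}\|v\|_{A_\Phi}$ for all $u,v\in A_\Phi(G)$ and some constant $C>0$ (so that the equivalent norm $C\|\cdot\|_{A_\Phi}$ is submultiplicative). -/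

import Mathlib

open MeasureTheory Filter Topology
open scoped ENNReal ZeroAtInfty

noncomputable section

namespace OrliczFourier

/-! ### N-functions and Orlicz spaces -/

/-- An `N`-function: a convex even function `Φ : ℝ → [0, ∞)` with `Φ(0) = 0`,
`Φ(x)/x → 0` as `x → 0` and `Φ(x)/x → ∞` as `x → ∞`. -/
structure IsNFunction (Φ : ℝ → ℝ) : Prop where
  convex : ConvexOn ℝ Set.univ Φ
  even : ∀ x, Φ (-x) = Φ x
  nonneg : ∀ x, 0 ≤ Φ x
  map_zero : Φ 0 = 0
  tendsto_zero : Tendsto (fun x => Φ x / x) (𝓝[≠] 0) (𝓝 0)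
  tendsto_atTop : Tendsto (fun x => Φ x / x) atTop atTop

/-- The complementary function `Ψ(y) = sup {x|y| - Φ(x) : x ≥ 0}`. For an `N`-function the set is
bounded above, because `Φ` grows superlinearly. -/
def complementary (Φ : ℝ → ℝ) (y : ℝ) : ℝ :=
  sSup {t : ℝ | ∃ x : ℝ, 0 ≤ x ∧ t = x * |y| - Φ x}

variable {G : Type*} [MeasurableSpace G]

/-- The modular `ρ_Φ(f) = ∫ Φ(|f|) dμ`, with values in `[0, ∞]`. -/
def modular (Φ : ℝ → ℝ) (μ : Measure G) (f : G → ℂ) : ℝ≥0∞ :=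
  ∫⁻ x, ENNReal.ofReal (Φ ‖f x‖) ∂μ

/-- The Morse-Transue space `M^Φ`, as a set of functions (not of classes). -/
def morseTransue (Φ : ℝ → ℝ) (μ : Measure G) : Set (G → ℂ) :=
  {f | AEStronglyMeasurable f μ ∧
    ∀ a : ℝ, 0 < a → modular Φ μ (fun x => (a : ℂ) * f x) < ∞}

/-- The Luxemburg-Nakano norm `N_Φ(f) = inf {k > 0 : ρ_Φ(f/k) ≤ 1}`, with values in `[0, ∞]`;
it is `∞` if there is no such `k`. -/
def luxemburgNorm (Φ : ℝ → ℝ) (μ : Measure G) (f : G → ℂ) : ℝ≥0∞ :=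
  ⨅ (k : ℝ) (_ : 0 < k) (_ : modular Φ μ (fun x => f x / (k : ℂ)) ≤ 1), ENNReal.ofReal k

/-- The Orlicz norm `‖f‖_Φ = sup {∫ |f g| dμ : g measurable, N_Ψ(g) ≤ 1}`, where `Ψ` is
complementary to `Φ`, with values in `[0, ∞]`. -/
def orliczNorm (Φ : ℝ → ℝ) (μ : Measure G) (f : G → ℂ) : ℝ≥0∞ :=
  ⨆ (g : G → ℂ) (_ : AEStronglyMeasurable g μ)
    (_ : luxemburgNorm (complementary Φ) μ g ≤ 1), ∫⁻ x, ‖f x * g x‖ₑ ∂μ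

/-! ### Convolution -/

section Convolution

variable [Group G]

/-- `(f * g)(x) = ∫ f(y) g(y⁻¹x) dμ(y)`. -/
def conv (μ : Measure G) (f g : G → ℂ) (x : G) : ℂ :=
  ∫ y, f y * g (y⁻¹ * x) ∂μ

/-- The convolution of `f` and `g` exists: `y ↦ f(y) g(y⁻¹x)` is integrable for almost all `x`. -/
def ConvExists (μ : Measure G) (f g : G → ℂ) : Prop :=
  ∀ᵐ x ∂μ, Integrable (fun y => f y * g (y⁻¹ * x)) μ

/-- `ǧ(x) = g(x⁻¹)`. -/
def check (g : G → ℂ) (x : G) : ℂ := g x⁻¹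

end Convolution

/-! ### Amenability -/

/-- Amenability with respect to a left Haar measure `μ`: there is a left invariant mean on
`L^∞(G)`, that is, a linear functional `m` with `‖m‖ = m(1) = 1` and `m(φ(x⁻¹ ·)) = m(φ)` for all
`x ∈ G` and `φ ∈ L^∞(G)`. -/
def IsAmenable [Group G] [MeasurableMul G] (μ : Measure G) [μ.IsMulLeftInvariant] : Prop :=
  ∃ m : Lp ℂ ∞ μ →L[ℂ] ℂ,
    ‖m‖ = 1 ∧ m ((memLp_top_const (1 : ℂ)).toLp (fun _ : G => (1 : ℂ))) = 1 ∧
    ∀ (x : G) (φ : Lp ℂ ∞ μ),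
      m (Lp.compMeasurePreserving (fun y => x⁻¹ * y) (measurePreserving_mul_left μ x⁻¹) φ) = m φ

/-! ### The space `A_Φ(G)` -/

section APhi

variable [Group G] [TopologicalSpace G]

/-- The sequences `f` in `M^Φ` and `g` in `M^Ψ` represent `u`: the sum of
`N_Φ(f_n) ‖g_n‖_Ψ` is finite and `u = ∑ f_n * ǧ_n`. -/
structure Represents (Φ : ℝ → ℝ) (μ : Measure G) (u : C₀(G, ℂ)) (f g : ℕ → G → ℂ) : Prop where
  mem_left : ∀ n, f n ∈ morseTransue Φ μ
  mem_right : ∀ n, g n ∈ morseTransue (complementary Φ) μ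
  sum_lt_top : ∑' n, luxemburgNorm Φ μ (f n) * orliczNorm (complementary Φ) μ (g n) < ∞
  hasSum : ∀ x, HasSum (fun n => conv μ (f n) (check (g n)) x) (u x)

/-- `A_Φ(G)`, as a subset of `C₀(G)`. -/
def APhi (Φ : ℝ → ℝ) (μ : Measure G) : Set C₀(G, ℂ) :=
  {u | ∃ f g : ℕ → G → ℂ, Represents Φ μ u f g}

/-- The norm of `A_Φ(G)`: the infimum of `∑ N_Φ(f_n) ‖g_n‖_Ψ` over all representations of `u`.
(The infimum over the empty set, for `u` outside `A_Φ(G)`, is never used.) -/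
def aPhiNorm (Φ : ℝ → ℝ) (μ : Measure G) (u : C₀(G, ℂ)) : ℝ :=
  (⨅ (f : ℕ → G → ℂ) (g : ℕ → G → ℂ) (_ : Represents Φ μ u f g),
    ∑' n, luxemburgNorm Φ μ (f n) * orliczNorm (complementary Φ) μ (g n)).toReal

/-- The subset `A` of `C₀(G)` with the function `N` is a Banach space. -/
structure IsBanachSubspace (A : Set C₀(G, ℂ)) (N : C₀(G, ℂ) → ℝ) : Prop where
  zero_mem : 0 ∈ A
  add_mem : ∀ u ∈ A, ∀ v ∈ A, u + v ∈ A
  smul_mem : ∀ (c : ℂ), ∀ u ∈ A, c • u ∈ A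
  norm_nonneg : ∀ u ∈ A, 0 ≤ N u
  norm_eq_zero_iff : ∀ u ∈ A, N u = 0 ↔ u = 0
  norm_add_le : ∀ u ∈ A, ∀ v ∈ A, N (u + v) ≤ N u + N v
  norm_smul : ∀ (c : ℂ), ∀ u ∈ A, N (c • u) = ‖c‖ * N u
  complete : ∀ s : ℕ → C₀(G, ℂ), (∀ n, s n ∈ A) →
    (∀ ε > 0, ∃ n₀, ∀ n ≥ n₀, ∀ k ≥ n₀, N (s n - s k) < ε) →
    ∃ v ∈ A, Tendsto (fun n => N (s n - v)) atTop (𝓝 0)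

/-- The subset `A` of `C₀(G)` with the norm `N` is a Banach algebra under convolution: it is a
Banach space, the convolution of any two elements exists and (as a class modulo null sets) lies
in `A`, it is bilinear and associative on `A`, and it is bounded,
`‖u * v‖ ≤ C ‖u‖ ‖v‖` for some constant `C > 0`, so that the equivalent norm `C ‖·‖` is
submultiplicative. The constant cannot be dropped, since multiplying the Haar measure by a constant
multiplies the convolution. -/
structure IsConvBanachAlgebra (μ : Measure G) (A : Set C₀(G, ℂ)) (N : C₀(G, ℂ) → ℝ) : Prop where
  banach : IsBanachSubspace A N
  conv_exists : ∀ u ∈ A, ∀ v ∈ A, ConvExists μ u v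
  conv_mem : ∀ u ∈ A, ∀ v ∈ A, ∃ w ∈ A, w =ᵐ[μ] conv μ u v
  add_conv : ∀ u ∈ A, ∀ v ∈ A, ∀ w ∈ A,
    conv μ (⇑(u + v)) w =ᵐ[μ] conv μ u w + conv μ v w
  conv_add : ∀ u ∈ A, ∀ v ∈ A, ∀ w ∈ A,
    conv μ u (⇑(v + w)) =ᵐ[μ] conv μ u v + conv μ u w
  smul_conv : ∀ (c : ℂ), ∀ u ∈ A, ∀ v ∈ A, conv μ (⇑(c • u)) v =ᵐ[μ] c • conv μ u v
  conv_smul : ∀ (c : ℂ), ∀ u ∈ A, ∀ v ∈ A, conv μ u (⇑(c • v)) =ᵐ[μ] c • conv μ u v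
  conv_assoc : ∀ u ∈ A, ∀ v ∈ A, ∀ w ∈ A,
    conv μ (conv μ u v) w =ᵐ[μ] conv μ u (conv μ v w)
  bounded : ∃ C : ℝ, 0 < C ∧ ∀ u ∈ A, ∀ v ∈ A, ∀ w ∈ A,
    w =ᵐ[μ] conv μ u v → N w ≤ C * N u * N v

end APhi

end OrliczFourier

end

/-!
The implications that need amenability are those from convolution to compactness; on a compact group
everything follows from the boundedness of the elements of `A_Φ(G)`.

*Banach space.* The norm of `A_Φ(G)`, with values in `[0, ∞]`, dominates the uniform norm by Hölder's
inequality, and it is countably subadditive, since representations of the terms of a series combine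
into a representation of the sum (`IsNFunction.aPhiENorm_le_tsum`). An extended norm on `C₀(G)` with
these two properties is complete where it is finite (`isBanachSubspace_of_tsum_le`). This holds for
every group.

*Compact groups.* If `G` is compact, then `u * (f * ǧ) = (u * f) * ǧ` for continuous `u`
(`IsNFunction.conv_check_assoc`), and `|u * f| ≤ ‖u‖_∞ ‖f‖_1` gives `N_Φ(u * f) ≤ C ‖u‖_∞ N_Φ(f)`.
So a representation of `v` is turned into one of `u * v`, with
`‖u * v‖_{A_Φ} ≤ C ‖u‖_∞ ‖v‖_{A_Φ} ≤ C ‖u‖_{A_Φ} ‖v‖_{A_Φ}`. As `G` is not assumed to be second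
countable, products of measurable functions on `G × G` are not available; Fubini's theorem is used
for continuous functions of compact support, and the rest is approximation.

*Noncompact groups.* If `G` is amenable and not compact, then some convolution diverges
(`IsAmenable.exists_not_convExists`). The Hahn-Banach theorem turns an invariant mean into almost
invariant convex combinations of translates (`IsAmenable.exists_almost_invariant`). Smoothing them
gives Reiter's condition in the following form (`IsAmenable.exists_almost_invariant_density`): for
compact `K` there are nonnegative functions `a, b` of compact support with `∫ b = 1` and
`∫ |a(z) - b(x⁻¹z)| dz ≤ 1/2` for `x ∈ K`. The functions `f = Φ⁻¹(a)` and `g = b / Φ⁻¹(b)` satisfy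
`Φ(f) = a` and `Ψ(g) ≤ b`, so `f * ǧ` has norm at most `8` in `A_Φ(G)`. Moreover
`f(y) g(x⁻¹y) ≥ min(a(y), b(x⁻¹y))`, so `f * ǧ ≥ 1/2` on `K`. These bounded local units
(`IsAmenable.exists_local_unit`) are summed: with `Kₙ` compact, `λ(Kₙ) > n 4ⁿ⁺¹`, and local units `uₙ`
for `Kₙ` and `vₙ` for `Kₙ⁻¹V`, where `V` is a compact neighbourhood of the identity, the functions
`u = ∑ 2⁻ⁿ uₙ` and `v = ∑ 2⁻ⁿ vₙ` lie in `A_Φ(G)`, and `∫ |u(y) v(y⁻¹x)| dy ≥ 4⁻ⁿ⁻¹ λ(Kₙ) > n` for all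
`n` and all `x ∈ V`.
-/

noncomputable section

namespace OrliczFourier

set_option linter.unusedSectionVars false

/-! ### N-functions and complementary functions -/

section NFunction

variable {Φ : ℝ → ℝ}

lemma IsNFunction.map_mul_le (h : IsNFunction Φ) {c : ℝ} (h0 : 0 ≤ c) (h1 : c ≤ 1) (x : ℝ) :
    Φ (c * x) ≤ c * Φ x := by
  have := h.convex.2 (Set.mem_univ x) (Set.mem_univ 0) h0 (sub_nonneg.2 h1) (by ring)
  simpa [h.map_zero] using this

lemma IsNFunction.mono (h : IsNFunction Φ) {x y : ℝ} (hx : 0 ≤ x) (hxy : x ≤ y) : Φ x ≤ Φ y := by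
  rcases hx.eq_or_lt with rfl | hx
  · rw [h.map_zero]; exact h.nonneg y
  have hy : 0 < y := hx.trans_le hxy
  have := h.map_mul_le (c := x / y) (by positivity) ((div_le_one hy).2 hxy) y
  rw [div_mul_cancel₀ _ hy.ne'] at this
  refine this.trans (mul_le_of_le_one_left (h.nonneg y) ((div_le_one hy).2 hxy))

lemma IsNFunction.bddAbove (h : IsNFunction Φ) (y : ℝ) :
    BddAbove {t : ℝ | ∃ x : ℝ, 0 ≤ x ∧ t = x * |y| - Φ x} := by
  obtain ⟨R, hR0, hR⟩ : ∃ R : ℝ, 0 < R ∧ ∀ x ≥ R, |y| ≤ Φ x / x := by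
    obtain ⟨R, hR⟩ := eventually_atTop.1 (h.tendsto_atTop.eventually_ge_atTop |y|)
    exact ⟨max R 1, by positivity, fun x hx => hR x ((le_max_left _ _).trans hx)⟩
  refine ⟨R * |y|, ?_⟩
  rintro _ ⟨x, hx, rfl⟩
  rcases le_total x R with hxR | hxR
  · have := mul_le_mul_of_nonneg_right hxR (abs_nonneg y)
    linarith [h.nonneg x]
  · have hx0 : 0 < x := hR0.trans_le hxR
    have := (le_div_iff₀ hx0).1 (hR x hxR)
    have : 0 ≤ R * |y| := by positivity
    linarith

/-- Young's inequality. -/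
lemma IsNFunction.mul_sub_le_complementary (h : IsNFunction Φ) {x : ℝ} (hx : 0 ≤ x) (y : ℝ) :
    x * |y| - Φ x ≤ complementary Φ y :=
  le_csSup (h.bddAbove y) ⟨x, hx, rfl⟩

lemma complementary_le {y C : ℝ} (hC : ∀ x, 0 ≤ x → x * |y| - Φ x ≤ C) :
    complementary Φ y ≤ C := by
  refine csSup_le ⟨_, 0, le_rfl, rfl⟩ ?_
  rintro _ ⟨x, hx, rfl⟩
  exact hC x hx

lemma IsNFunction.complementary_nonneg (h : IsNFunction Φ) (y : ℝ) : 0 ≤ complementary Φ y := by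
  simpa [h.map_zero] using h.mul_sub_le_complementary le_rfl y

lemma IsNFunction.complementary_zero (h : IsNFunction Φ) : complementary Φ 0 = 0 :=
  le_antisymm (complementary_le fun x _ => by simpa using h.nonneg x) (h.complementary_nonneg 0)

lemma IsNFunction.complementary_mono (h : IsNFunction Φ) {x y : ℝ} (hx : 0 ≤ x) (hxy : x ≤ y) :
    complementary Φ x ≤ complementary Φ y := by
  refine complementary_le fun t ht => le_trans ?_ (h.mul_sub_le_complementary ht y)
  rw [abs_of_nonneg hx, abs_of_nonneg (hx.trans hxy)]
  gcongr

lemma IsNFunction.mul_sub_complementary_le (h : IsNFunction Φ) {x : ℝ} (hx : 0 ≤ x) (y : ℝ) :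
    x * |y| - complementary Φ x ≤ Φ |y| := by
  have := h.mul_sub_le_complementary (abs_nonneg y) x
  rw [abs_of_nonneg hx] at this
  linarith

/-- Young's inequality for the pair `Ψ, Ψ*` where `Ψ` is complementary to `Φ`. -/
lemma IsNFunction.mul_le_add_bicomplementary (h : IsNFunction Φ) {x y : ℝ} (hx : 0 ≤ x)
    (hy : 0 ≤ y) : x * y ≤ complementary Φ x + complementary (complementary Φ) y := by
  have hb : BddAbove {t : ℝ | ∃ x : ℝ, 0 ≤ x ∧ t = x * |y| - complementary Φ x} := by
    refine ⟨Φ |y|, ?_⟩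
    rintro _ ⟨x, hx, rfl⟩
    exact h.mul_sub_complementary_le hx y
  have h1 : x * |y| - complementary Φ x ≤ complementary (complementary Φ) y :=
    le_csSup hb ⟨x, hx, rfl⟩
  rw [abs_of_nonneg hy] at h1
  linarith

/-- The easy half `Φ** ≤ Φ` of the biconjugation theorem. -/
lemma IsNFunction.bicomplementary_le (h : IsNFunction Φ) (y : ℝ) :
    complementary (complementary Φ) |y| ≤ Φ |y| :=
  complementary_le fun x hx => by simpa using h.mul_sub_complementary_le hx |y|

/-- The inequality `Ψ(Φ(q)/q) ≤ Φ(q)`: the supremum defining the left side is controlled separately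
for `x ≤ q`, by `x Φ(q)/q ≤ Φ(q)`, and for `x ≥ q`, by `x Φ(q)/q ≤ Φ(x)`. -/
lemma IsNFunction.complementary_div_le (h : IsNFunction Φ) {q : ℝ} (hq : 0 < q) :
    complementary Φ (Φ q / q) ≤ Φ q := by
  refine complementary_le fun x hx => ?_
  rw [abs_of_nonneg (div_nonneg (h.nonneg q) hq.le)]
  rcases le_total x q with hxq | hxq
  · have h1 : x * (Φ q / q) ≤ q * (Φ q / q) :=
      mul_le_mul_of_nonneg_right hxq (div_nonneg (h.nonneg q) hq.le)
    rw [mul_div_cancel₀ _ hq.ne'] at h1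
    linarith [h.nonneg x]
  · have hx0 : 0 < x := hq.trans_le hxq
    have h1 := h.map_mul_le (c := q / x) (by positivity) ((div_le_one hx0).2 hxq) x
    rw [div_mul_cancel₀ _ hx0.ne'] at h1
    have h2 : x * (Φ q / q) ≤ x * ((q / x * Φ x) / q) := by gcongr
    have h3 : x * ((q / x * Φ x) / q) = Φ x := by field_simp
    linarith [h.nonneg q]

lemma aemeasurable_ofReal_comp_norm_of_mono {G : Type*} [MeasurableSpace G] {μ : Measure G} {F : ℝ → ℝ}
    (hF : ∀ x y, 0 ≤ x → x ≤ y → F x ≤ F y) {f : G → ℂ} (hf : AEStronglyMeasurable f μ) :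
    AEMeasurable (fun x => ENNReal.ofReal (F ‖f x‖)) μ := by
  have hm : Monotone fun t : ℝ => F (max t 0) := fun s t hst =>
    hF _ _ (le_max_right _ _) (max_le_max hst le_rfl)
  have := (hm.measurable.comp_aemeasurable hf.norm.aemeasurable).ennreal_ofReal
  simpa [Function.comp_def] using this

end NFunction

/-! ### Orlicz norms -/

section Norms

variable {G : Type*} [MeasurableSpace G] {μ : Measure G} {Φ : ℝ → ℝ}

lemma luxemburgNorm_le_ofReal {f : G → ℂ} {k : ℝ} (hk : 0 < k)
    (h : modular Φ μ (fun x => f x / (k : ℂ)) ≤ 1) : luxemburgNorm Φ μ f ≤ ENNReal.ofReal k :=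
  iInf_le_of_le k <| iInf_le_of_le hk <| iInf_le _ h

lemma exists_of_luxemburgNorm_lt {f : G → ℂ} {r : ℝ≥0∞} (h : luxemburgNorm Φ μ f < r) :
    ∃ k : ℝ, 0 < k ∧ ENNReal.ofReal k < r ∧ modular Φ μ (fun x => f x / (k : ℂ)) ≤ 1 := by
  simp only [luxemburgNorm, iInf_lt_iff] at h
  obtain ⟨k, hk, hm, hr⟩ := h
  exact ⟨k, hk, hr, hm⟩

lemma luxemburgNorm_const_mul_le (c : ℂ) (f : G → ℂ) (h0 : Φ 0 = 0) :
    luxemburgNorm Φ μ (fun x => c * f x) ≤ ‖c‖ₑ * luxemburgNorm Φ μ f := by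
  rcases eq_or_ne c 0 with rfl | hc
  · simp only [enorm_zero, zero_mul]
    refine ENNReal.le_of_forall_pos_le_add fun ε hε _ => ?_
    have := luxemburgNorm_le_ofReal (Φ := Φ) (μ := μ) (f := fun _ => (0 : ℂ)) (k := ε) hε
      (by simp [modular, h0])
    simpa using this
  · have hc' : ‖c‖ₑ ≠ 0 := by simpa using hc
    rw [luxemburgNorm.eq_def Φ μ f]
    simp only [ENNReal.mul_iInf_of_ne hc' enorm_ne_top]
    refine le_iInf fun k => le_iInf fun hk => le_iInf fun hm => ?_
    rw [← ofReal_norm, ← ENNReal.ofReal_mul (norm_nonneg c)]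
    refine luxemburgNorm_le_ofReal (mul_pos (norm_pos_iff.2 hc) hk) (le_of_eq_of_le ?_ hm)
    refine lintegral_congr fun x => ?_
    have : ‖c‖ ≠ 0 := norm_ne_zero_iff.2 hc
    congr 2
    simp only [norm_div, norm_mul, Complex.norm_real, norm_norm]
    field_simp

lemma IsNFunction.luxemburgNorm_zero (h : IsNFunction Φ) :
    luxemburgNorm Φ μ (fun _ : G => (0 : ℂ)) = 0 := by
  have := luxemburgNorm_const_mul_le (μ := μ) (Φ := Φ) 0 (fun _ : G => (0 : ℂ)) h.map_zero
  simpa using this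

lemma IsNFunction.luxemburgNorm_lt_top (h : IsNFunction Φ) {f : G → ℂ}
    (hf : modular Φ μ f < ∞) : luxemburgNorm Φ μ f < ∞ := by
  set k : ℝ := (modular Φ μ f).toReal + 1 with hk
  have hk0 : 0 < k := by positivity
  refine (luxemburgNorm_le_ofReal hk0 ?_).trans_lt ENNReal.ofReal_lt_top
  have h1 : modular Φ μ (fun x => f x / (k : ℂ)) ≤ ENNReal.ofReal k⁻¹ * modular Φ μ f := by
    unfold modular
    rw [← lintegral_const_mul' _ _ ENNReal.ofReal_ne_top]
    refine lintegral_mono fun x => ?_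
    rw [← ENNReal.ofReal_mul (by positivity)]
    refine ENNReal.ofReal_le_ofReal ?_
    have := h.map_mul_le (c := k⁻¹) (by positivity)
      (inv_le_one_of_one_le₀ (by simp [hk])) ‖f x‖
    refine le_of_eq_of_le ?_ this
    rw [norm_div, Complex.norm_real, Real.norm_of_nonneg hk0.le, div_eq_inv_mul]
  refine h1.trans ?_
  rw [← ENNReal.ofReal_toReal hf.ne, ← ENNReal.ofReal_mul (by positivity)]
  rw [ENNReal.ofReal_le_one, inv_mul_le_iff₀ hk0]
  linarith

lemma luxemburgNorm_le_of_le {Φ' : ℝ → ℝ} (h : ∀ t : ℝ, 0 ≤ t → Φ' t ≤ Φ t) (f : G → ℂ) :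
    luxemburgNorm Φ' μ f ≤ luxemburgNorm Φ μ f := by
  refine le_iInf fun k => le_iInf fun hk => le_iInf fun hm => luxemburgNorm_le_ofReal hk ?_
  exact (lintegral_mono fun x => ENNReal.ofReal_le_ofReal (h _ (norm_nonneg _))).trans hm

/-- `‖g‖_Ψ ≤ 2 (ρ_Ψ(g) + 1)`, by Young's inequality. The factor `2` accounts for the fact that
`N_{Ψ*}(f) ≤ 1` is only used in the form `ρ_{Ψ*}(f / k) ≤ 1` for some `k < 2`. -/
lemma IsNFunction.orliczNorm_complementary_le (h : IsNFunction Φ) {g : G → ℂ}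
    (hg : AEStronglyMeasurable g μ) :
    orliczNorm (complementary Φ) μ g ≤ 2 * (modular (complementary Φ) μ g + 1) := by
  refine iSup_le fun f => iSup_le fun hf => iSup_le fun hN => ?_
  obtain ⟨k, hk, hk2, hm⟩ := exists_of_luxemburgNorm_lt
    (hN.trans_lt (by norm_num : (1 : ℝ≥0∞) < 2))
  have h1 : ∀ x, ‖g x * f x‖ₑ ≤ ENNReal.ofReal k * (ENNReal.ofReal (complementary Φ ‖g x‖) +
      ENNReal.ofReal (complementary (complementary Φ) ‖f x / (k : ℂ)‖)) := fun x => by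
    refine le_trans ?_ (mul_le_mul_right ENNReal.ofReal_add_le _)
    rw [← ENNReal.ofReal_mul hk.le, ← ofReal_norm]
    refine ENNReal.ofReal_le_ofReal ?_
    have := h.mul_le_add_bicomplementary (norm_nonneg (g x)) (norm_nonneg (f x / (k : ℂ)))
    refine le_trans (le_of_eq ?_) (mul_le_mul_of_nonneg_left this hk.le)
    rw [norm_mul, norm_div, Complex.norm_real, Real.norm_of_nonneg hk.le]
    field_simp
  refine (lintegral_mono h1).trans ?_
  rw [lintegral_const_mul' _ _ ENNReal.ofReal_ne_top, lintegral_add_left'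
    (aemeasurable_ofReal_comp_norm_of_mono (fun x y hx hxy => h.complementary_mono hx hxy) hg)]
  exact mul_le_mul' hk2.le (add_le_add le_rfl hm)

lemma IsNFunction.orliczNorm_complementary_lt_top (h : IsNFunction Φ) {g : G → ℂ}
    (hg : g ∈ morseTransue (complementary Φ) μ) : orliczNorm (complementary Φ) μ g < ∞ := by
  refine (h.orliczNorm_complementary_le hg.1).trans_lt ?_
  have := hg.2 1 one_pos
  simp only [Complex.ofReal_one, one_mul] at this
  exact ENNReal.mul_lt_top (by simp) (ENNReal.add_lt_top.2 ⟨this, by simp⟩)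

lemma IsNFunction.luxemburgNorm_lt_top_of_mem (h : IsNFunction Φ) {f : G → ℂ}
    (hf : f ∈ morseTransue Φ μ) : luxemburgNorm Φ μ f < ∞ :=
  h.luxemburgNorm_lt_top (by simpa using hf.2 1 one_pos)

/-- Hölder's inequality. Since the Orlicz norm for `Ψ` is a supremum over the unit ball of `N_{Ψ*}`,
the inequality `Ψ* = Φ** ≤ Φ` is enough. -/
lemma IsNFunction.lintegral_enorm_mul_le (h : IsNFunction Φ) {f g : G → ℂ}
    (hf : f ∈ morseTransue Φ μ) (hg : g ∈ morseTransue (complementary Φ) μ) :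
    ∫⁻ x, ‖f x * g x‖ₑ ∂μ ≤ luxemburgNorm Φ μ f * orliczNorm (complementary Φ) μ g := by
  have key : ∀ k : ℝ, 0 < k → modular Φ μ (fun x => f x / (k : ℂ)) ≤ 1 →
      ∫⁻ x, ‖f x * g x‖ₑ ∂μ ≤ ENNReal.ofReal k * orliczNorm (complementary Φ) μ g := by
    intro k hk hm
    have h1 : luxemburgNorm (complementary (complementary Φ)) μ (fun x => f x / (k : ℂ)) ≤ 1 := by
      refine (luxemburgNorm_le_of_le (Φ := Φ) (fun t ht => ?_) _).trans ?_
      · simpa [abs_of_nonneg ht] using h.bicomplementary_le t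
      · simpa using luxemburgNorm_le_ofReal (Φ := Φ) (μ := μ)
          (f := fun x => f x / (k : ℂ)) one_pos (by simpa using hm)
    have h2 : ∫⁻ x, ‖g x * (f x / (k : ℂ))‖ₑ ∂μ ≤ orliczNorm (complementary Φ) μ g :=
      le_iSup_of_le (fun x => f x / (k : ℂ)) <|
        le_iSup_of_le (by simpa only [div_eq_mul_inv] using hf.1.mul_const (k : ℂ)⁻¹) <|
          le_iSup_of_le h1 le_rfl
    refine le_trans (le_of_eq ?_) (mul_le_mul_right h2 _)
    rw [← lintegral_const_mul' _ _ ENNReal.ofReal_ne_top]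
    refine lintegral_congr fun x => ?_
    rw [← ofReal_norm, ← ofReal_norm, ← ENNReal.ofReal_mul hk.le]
    congr 1
    rw [norm_mul, norm_mul, norm_div, Complex.norm_real, Real.norm_of_nonneg hk.le]
    field_simp
  have hN := h.luxemburgNorm_lt_top_of_mem hf
  have hO := h.orliczNorm_complementary_lt_top hg
  rcases eq_or_ne (orliczNorm (complementary Φ) μ g) 0 with h0 | h0
  · obtain ⟨k, hk, -, hm⟩ := exists_of_luxemburgNorm_lt hN
    simpa [h0] using key k hk hm
  · rw [luxemburgNorm, mul_comm]
    simp only [ENNReal.mul_iInf_of_ne h0 hO.ne]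
    refine le_iInf fun k => le_iInf fun hk => le_iInf fun hm => ?_
    rw [mul_comm]
    exact key k hk hm

lemma mem_morseTransue_of_bounded {F : ℝ → ℝ} (hF0 : F 0 = 0)
    (hF : ∀ x y, 0 ≤ x → x ≤ y → F x ≤ F y) {f : G → ℂ} (hf : AEStronglyMeasurable f μ)
    {s : Set G} (hs : μ s ≠ ∞) (hfs : ∀ x ∉ s, f x = 0) {C : ℝ} (hC : ∀ x, ‖f x‖ ≤ C) :
    f ∈ morseTransue F μ := by
  refine ⟨hf, fun a ha => ?_⟩
  have h1 : ∀ x, ENNReal.ofReal (F ‖(a : ℂ) * f x‖) ≤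
      (toMeasurable μ s).indicator (fun _ => ENNReal.ofReal (F (a * C))) x := fun x => by
    by_cases hx : x ∈ toMeasurable μ s
    · rw [Set.indicator_of_mem hx]
      refine ENNReal.ofReal_le_ofReal (hF _ _ (norm_nonneg _) ?_)
      rw [norm_mul, Complex.norm_real, Real.norm_of_nonneg ha.le]
      exact mul_le_mul_of_nonneg_left (hC x) ha.le
    · rw [Set.indicator_of_notMem hx, hfs x fun h => hx (subset_toMeasurable μ s h)]
      simp [hF0]
  refine (lintegral_mono h1).trans_lt ?_
  rw [lintegral_indicator (measurableSet_toMeasurable μ s), setLIntegral_const,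
    measure_toMeasurable]
  exact ENNReal.mul_lt_top ENNReal.ofReal_lt_top hs.lt_top

lemma IsNFunction.const_mul_mem (h : IsNFunction Φ) (c : ℂ) {f : G → ℂ}
    (hf : f ∈ morseTransue Φ μ) : (fun x => c * f x) ∈ morseTransue Φ μ := by
  refine ⟨hf.1.const_mul c, fun a ha => ?_⟩
  refine lt_of_le_of_lt (lintegral_mono fun x => ENNReal.ofReal_le_ofReal ?_)
    (hf.2 (a * ‖c‖ + 1) (by positivity))
  refine h.mono (norm_nonneg _) ?_
  rw [norm_mul, norm_mul, norm_mul, Complex.norm_real, Complex.norm_real, Real.norm_of_nonneg ha.le,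
    Real.norm_of_nonneg (by positivity), ← mul_assoc]
  gcongr
  linarith

lemma zero_mem_morseTransue {F : ℝ → ℝ} (h0 : F 0 = 0) : (fun _ => 0 : G → ℂ) ∈ morseTransue F μ :=
  ⟨aestronglyMeasurable_const, fun a _ => by simp [modular, h0]⟩

end Norms

/-! ### The extended norm of `A_Φ(G)` -/

section ENorm

lemma summable_of_tsum_enorm_lt_top {ι E : Type*} [NormedAddCommGroup E] [CompleteSpace E]
    {f : ι → E} (h : ∑' i, ‖f i‖ₑ < ∞) : Summable f := by
  have := ENNReal.tsum_coe_ne_top_iff_summable.1 (h.ne : ∑' i, ((‖f i‖₊ : NNReal) : ℝ≥0∞) ≠ ∞)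
  exact Summable.of_norm (NNReal.summable_coe.2 this)

lemma norm_apply_le {X : Type*} [TopologicalSpace X] (u : C₀(X, ℂ)) (x : X) : ‖u x‖ ≤ ‖u‖ := by
  rw [← ZeroAtInftyContinuousMap.norm_toBCF_eq_norm]
  exact u.toBCF.norm_coe_le_norm x

variable {G : Type*} [MeasurableSpace G] [Group G] [TopologicalSpace G]

/-- The norm of `A_Φ(G)` with values in `[0, ∞]`; it is `∞` outside `A_Φ(G)`. -/
def aPhiENorm (Φ : ℝ → ℝ) (μ : Measure G) (u : C₀(G, ℂ)) : ℝ≥0∞ :=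
  ⨅ (f : ℕ → G → ℂ) (g : ℕ → G → ℂ) (_ : Represents Φ μ u f g),
    ∑' n, luxemburgNorm Φ μ (f n) * orliczNorm (complementary Φ) μ (g n)

variable {μ : Measure G} {Φ : ℝ → ℝ}

lemma exists_represents_of_aPhiENorm_lt {u : C₀(G, ℂ)} {r : ℝ≥0∞} (h : aPhiENorm Φ μ u < r) :
    ∃ f g, Represents Φ μ u f g ∧
      ∑' n, luxemburgNorm Φ μ (f n) * orliczNorm (complementary Φ) μ (g n) < r := by
  simp only [aPhiENorm, iInf_lt_iff] at h
  obtain ⟨f, g, hfg, hr⟩ := h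
  exact ⟨f, g, hfg, hr⟩

lemma Represents.aPhiENorm_le {u : C₀(G, ℂ)} {f g : ℕ → G → ℂ} (h : Represents Φ μ u f g) :
    aPhiENorm Φ μ u ≤ ∑' n, luxemburgNorm Φ μ (f n) * orliczNorm (complementary Φ) μ (g n) :=
  iInf_le_of_le f <| iInf_le_of_le g <| iInf_le _ h

lemma mem_aPhi_iff {u : C₀(G, ℂ)} : u ∈ APhi Φ μ ↔ aPhiENorm Φ μ u < ∞ := by
  constructor
  · rintro ⟨f, g, h⟩
    exact h.aPhiENorm_le.trans_lt h.sum_lt_top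
  · intro h
    obtain ⟨f, g, h, -⟩ := exists_represents_of_aPhiENorm_lt h
    exact ⟨f, g, h⟩

variable [IsTopologicalGroup G] [BorelSpace G] [μ.IsMulLeftInvariant]

lemma luxemburgNorm_translate (f : G → ℂ) (x : G) :
    luxemburgNorm Φ μ (fun y => f (x * y)) = luxemburgNorm Φ μ f := by
  have : ∀ k : ℝ, modular Φ μ (fun y => f (x * y) / (k : ℂ)) =
      modular Φ μ (fun y => f y / (k : ℂ)) := fun k =>
    lintegral_mul_left_eq_self (fun y => ENNReal.ofReal (Φ ‖f y / (k : ℂ)‖)) x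
  simp only [luxemburgNorm, this]

lemma translate_mem_morseTransue {f : G → ℂ} (hf : f ∈ morseTransue Φ μ) (x : G) :
    (fun y => f (x * y)) ∈ morseTransue Φ μ := by
  refine ⟨hf.1.comp_measurePreserving (measurePreserving_mul_left μ x), fun a ha => ?_⟩
  refine lt_of_eq_of_lt ?_ (hf.2 a ha)
  exact lintegral_mul_left_eq_self (fun y => ENNReal.ofReal (Φ ‖(a : ℂ) * f y‖)) x

lemma conv_check_eq (f g : G → ℂ) (x : G) :
    conv μ f (check g) x = ∫ y, f (x * y) * g y ∂μ := by
  rw [← integral_mul_left_eq_self _ x⁻¹]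
  simp [conv, check]

lemma conv_check_eq' (f g : G → ℂ) (x : G) :
    conv μ f (check g) x = ∫ y, f y * g (x⁻¹ * y) ∂μ := by
  simp [conv, check]

lemma IsNFunction.lintegral_translate_le (h : IsNFunction Φ) {f g : G → ℂ}
    (hf : f ∈ morseTransue Φ μ) (hg : g ∈ morseTransue (complementary Φ) μ) (x : G) :
    ∫⁻ y, ‖f (x * y) * g y‖ₑ ∂μ ≤ luxemburgNorm Φ μ f * orliczNorm (complementary Φ) μ g := by
  simpa [luxemburgNorm_translate] using
    h.lintegral_enorm_mul_le (translate_mem_morseTransue hf x) hg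

lemma IsNFunction.integrable_translate_mul (h : IsNFunction Φ) {f g : G → ℂ}
    (hf : f ∈ morseTransue Φ μ) (hg : g ∈ morseTransue (complementary Φ) μ) (x : G) :
    Integrable (fun y => f (x * y) * g y) μ :=
  ⟨(translate_mem_morseTransue hf x).1.mul hg.1, (h.lintegral_translate_le hf hg x).trans_lt
    (ENNReal.mul_lt_top (h.luxemburgNorm_lt_top_of_mem hf) (h.orliczNorm_complementary_lt_top hg))⟩

lemma IsNFunction.enorm_conv_le (h : IsNFunction Φ) {f g : G → ℂ}
    (hf : f ∈ morseTransue Φ μ) (hg : g ∈ morseTransue (complementary Φ) μ) (x : G) :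
    ‖conv μ f (check g) x‖ₑ ≤ luxemburgNorm Φ μ f * orliczNorm (complementary Φ) μ g := by
  rw [conv_check_eq]
  exact (enorm_integral_le_lintegral_enorm _).trans (h.lintegral_translate_le hf hg x)

lemma enorm_le_of_forall_enorm_le {u : C₀(G, ℂ)} {r : ℝ≥0∞} (h : ∀ x, ‖u x‖ₑ ≤ r) : ‖u‖ₑ ≤ r := by
  rcases eq_or_ne r ∞ with rfl | hr
  · exact le_top
  lift r to NNReal using hr
  rw [← ofReal_norm, ← ENNReal.ofReal_coe_nnreal]
  refine ENNReal.ofReal_le_ofReal ?_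
  rw [← ZeroAtInftyContinuousMap.norm_toBCF_eq_norm]
  refine (BoundedContinuousFunction.norm_le r.2).2 fun x => ?_
  have := h x
  rw [← ofReal_norm, ← ENNReal.ofReal_coe_nnreal] at this
  exact (ENNReal.ofReal_le_ofReal_iff r.2).1 this

lemma hasSum_apply {X : Type*} [TopologicalSpace X] {u : ℕ → C₀(X, ℂ)} {v : C₀(X, ℂ)}
    (hv : HasSum u v) (x : X) : HasSum (fun k => u k x) (v x) := by
  let e : C₀(X, ℂ) →+ ℂ :=
    { toFun := fun w => w x
      map_zero' := rfl
      map_add' := fun _ _ => rfl }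
  exact hv.map e (AddMonoidHomClass.continuous_of_bound e 1 fun w => by
    rw [one_mul]; exact norm_apply_le w x)

lemma IsNFunction.enorm_le_aPhiENorm (h : IsNFunction Φ) (u : C₀(G, ℂ)) :
    ‖u‖ₑ ≤ aPhiENorm Φ μ u := by
  refine le_iInf fun f => le_iInf fun g => le_iInf fun hfg => ?_
  refine enorm_le_of_forall_enorm_le fun x => ?_
  rw [← (hfg.hasSum x).tsum_eq]
  exact enorm_tsum_le_tsum_enorm.trans
    (ENNReal.tsum_le_tsum fun n => h.enorm_conv_le (hfg.mem_left n) (hfg.mem_right n) x)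

lemma IsNFunction.aPhiENorm_smul_le (h : IsNFunction Φ) (c : ℂ) (u : C₀(G, ℂ)) :
    aPhiENorm Φ μ (c • u) ≤ ‖c‖ₑ * aPhiENorm Φ μ u := by
  -- For `c = 0` the factor does not commute with the infimum, which may be over the empty set.
  have key : ∀ f g, Represents Φ μ u f g → aPhiENorm Φ μ (c • u) ≤ ‖c‖ₑ *
      ∑' n, luxemburgNorm Φ μ (f n) * orliczNorm (complementary Φ) μ (g n) := by
    intro f g hfg
    have hle : ∑' n, luxemburgNorm Φ μ (fun x => c * f n x) * orliczNorm (complementary Φ) μ (g n) ≤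
        ‖c‖ₑ * ∑' n, luxemburgNorm Φ μ (f n) * orliczNorm (complementary Φ) μ (g n) := by
      rw [← ENNReal.tsum_mul_left]
      refine ENNReal.tsum_le_tsum fun n => ?_
      rw [← mul_assoc]
      exact mul_le_mul_left (luxemburgNorm_const_mul_le c (f n) h.map_zero) _
    have hrep : Represents Φ μ (c • u) (fun n x => c * f n x) g :=
      { mem_left := fun n => h.const_mul_mem c (hfg.mem_left n)
        mem_right := hfg.mem_right
        sum_lt_top := hle.trans_lt (ENNReal.mul_lt_top enorm_lt_top hfg.sum_lt_top)
        hasSum := fun x => by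
          have := (hfg.hasSum x).mul_left c
          simpa [conv, mul_assoc, integral_const_mul] using this }
    exact hrep.aPhiENorm_le.trans hle
  rcases eq_or_ne c 0 with rfl | hc
  · have hrep : Represents Φ μ (0 : C₀(G, ℂ)) (fun _ _ => 0) (fun _ _ => 0) :=
      { mem_left := fun n => zero_mem_morseTransue h.map_zero
        mem_right := fun n => zero_mem_morseTransue h.complementary_zero
        sum_lt_top := by simp [h.luxemburgNorm_zero]
        hasSum := fun x => by simp [conv] }
    simpa [h.luxemburgNorm_zero] using hrep.aPhiENorm_le
  · conv_rhs => rw [aPhiENorm]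
    simp only [ENNReal.mul_iInf_of_ne (by simpa using hc : ‖c‖ₑ ≠ 0) enorm_ne_top]
    exact le_iInf fun f => le_iInf fun g => le_iInf fun hfg => key f g hfg

/-- Countable subadditivity of the norm of `A_Φ(G)`. The representations of the summands are
combined into one by means of a bijection `ℕ × ℕ ≃ ℕ`. -/
lemma IsNFunction.aPhiENorm_le_tsum (h : IsNFunction Φ) {u : ℕ → C₀(G, ℂ)} {v : C₀(G, ℂ)}
    (hv : HasSum u v) : aPhiENorm Φ μ v ≤ ∑' k, aPhiENorm Φ μ (u k) := by
  rcases eq_or_ne (∑' k, aPhiENorm Φ μ (u k)) ∞ with htop | htop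
  · rw [htop]; exact le_top
  refine ENNReal.le_of_forall_pos_le_add fun ε hε _ => ?_
  obtain ⟨δ, hδ, hδε⟩ := ENNReal.exists_pos_sum_of_countable' (ENNReal.coe_pos.2 hε).ne' ℕ
  have hk : ∀ k, aPhiENorm Φ μ (u k) < aPhiENorm Φ μ (u k) + δ k := fun k =>
    ENNReal.lt_add_right (ENNReal.ne_top_of_tsum_ne_top htop k) (hδ k).ne'
  choose f g hfg hlt using fun k => exists_represents_of_aPhiENorm_lt (hk k)
  set F : ℕ × ℕ → ℝ≥0∞ := fun p =>
    luxemburgNorm Φ μ (f p.1 p.2) * orliczNorm (complementary Φ) μ (g p.1 p.2) with hF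
  have hsum : ∑' p, F p ≤ ∑' k, aPhiENorm Φ μ (u k) + ε := by
    rw [ENNReal.tsum_prod' (f := F)]
    calc ∑' k, ∑' n, F (k, n) ≤ ∑' k, (aPhiENorm Φ μ (u k) + δ k) :=
          ENNReal.tsum_le_tsum fun k => (hlt k).le
      _ = ∑' k, aPhiENorm Φ μ (u k) + ∑' k, δ k := ENNReal.tsum_add
      _ ≤ _ := by gcongr
  let e : ℕ ≃ ℕ × ℕ := Nat.pairEquiv.symm
  have hsum' : ∑' n, F (e n) = ∑' p, F p := e.tsum_eq F
  have hfin : ∑' p, F p < ∞ := hsum.trans_lt (by simpa [lt_top_iff_ne_top] using htop)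
  have hrep : Represents Φ μ v (fun n => f (e n).1 (e n).2) (fun n => g (e n).1 (e n).2) :=
    { mem_left := fun n => (hfg _).mem_left _
      mem_right := fun n => (hfg _).mem_right _
      sum_lt_top := by
        change ∑' n, F (e n) < ∞
        rwa [hsum']
      hasSum := fun x => by
        set c : ℕ × ℕ → ℂ := fun p => conv μ (f p.1 p.2) (check (g p.1 p.2)) x with hc
        change HasSum (c ∘ e) (v x)
        rw [e.hasSum_iff]
        have hcs : Summable c := by
          refine summable_of_tsum_enorm_lt_top (lt_of_le_of_lt ?_ hfin)
          exact ENNReal.tsum_le_tsum fun p =>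
            h.enorm_conv_le ((hfg _).mem_left _) ((hfg _).mem_right _) x
        have h1 : HasSum (fun k => u k x) (∑' p, c p) :=
          hcs.hasSum.prod_fiberwise fun k => (hfg k).hasSum x
        rw [← h1.unique (hasSum_apply hv x)]
        exact hcs.hasSum }
  refine hrep.aPhiENorm_le.trans ?_
  change ∑' n, F (e n) ≤ _
  rw [hsum']
  exact hsum

end ENorm

/-! ### Banach spaces defined by extended norms -/

section Banach

variable {G : Type*} [TopologicalSpace G]

/-- An extended norm on `C₀(G)` that dominates the uniform norm and is countably subadditive is
complete on the subspace where it is finite: the limit of a Cauchy sequence is the sum, in `C₀(G)`,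
of a telescoping series, and the tails of this series are controlled by countable subadditivity. -/
theorem isBanachSubspace_of_tsum_le {e : C₀(G, ℂ) → ℝ≥0∞} (hle : ∀ u, ‖u‖ₑ ≤ e u)
    (hsmul : ∀ (c : ℂ) u, e (c • u) ≤ ‖c‖ₑ * e u)
    (htsum : ∀ {u : ℕ → C₀(G, ℂ)} {v}, HasSum u v → e v ≤ ∑' k, e (u k)) :
    IsBanachSubspace {u | e u < ∞} (fun u => (e u).toReal) := by
  have h0 : e 0 = 0 := by simpa using hsmul 0 0
  have hadd : ∀ u v, e (u + v) ≤ e u + e v := by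
    intro u v
    -- Subadditivity is the case of the series `u + v + 0 + 0 + ⋯`.
    have hs : HasSum (fun k : ℕ => if k = 0 then u else if k = 1 then v else 0) (u + v) := by
      have : HasSum (fun k : ℕ => if k = 0 then u else if k = 1 then v else 0)
          (∑ k ∈ Finset.range 2, if k = 0 then u else if k = 1 then v else 0) :=
        hasSum_sum_of_ne_finset_zero fun k hk => by
          simp only [Finset.mem_range, not_lt] at hk
          rw [if_neg (by omega), if_neg (by omega)]
      simpa [Finset.sum_range_succ] using this
    refine (htsum hs).trans ?_
    rw [tsum_eq_sum (s := Finset.range 2)]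
    · simp [Finset.sum_range_succ]
    · intro k hk
      simp only [Finset.mem_range, not_lt] at hk
      rw [if_neg (by omega), if_neg (by omega), h0]
  have hneg : ∀ u, e (-u) ≤ e u := fun u => by
    have h1 : (-1 : ℂ) • u = -u := by ext; simp
    simpa [h1] using hsmul (-1) u
  have hsub : ∀ u v w, e (u - w) ≤ e (u - v) + e (v - w) := fun u v w => by
    simpa using hadd (u - v) (v - w)
  have hsubmem : ∀ {u v}, e u < ∞ → e v < ∞ → e (u - v) < ∞ := fun {u v} hu hv => by
    rw [sub_eq_add_neg]
    exact (hadd _ _).trans_lt (ENNReal.add_lt_top.2 ⟨hu, (hneg v).trans_lt hv⟩)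
  constructor
  · simp [h0]
  · exact fun u hu v hv => (hadd u v).trans_lt (ENNReal.add_lt_top.2 ⟨hu, hv⟩)
  · exact fun c u hu => (hsmul c u).trans_lt (ENNReal.mul_lt_top enorm_lt_top hu)
  · exact fun u _ => ENNReal.toReal_nonneg
  · intro u hu
    constructor
    · intro h
      rcases (ENNReal.toReal_eq_zero_iff _).1 h with h | h
      · have := hle u
        rw [h, nonpos_iff_eq_zero, ← ofReal_norm, ENNReal.ofReal_eq_zero] at this
        ext x
        simpa using (norm_apply_le u x).trans this
      · exact absurd h (ne_of_lt hu)
    · rintro rfl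
      simp [h0]
  · intro u hu v hv
    rw [← ENNReal.toReal_add (ne_of_lt hu) (ne_of_lt hv)]
    exact ENNReal.toReal_mono (ENNReal.add_lt_top.2 ⟨hu, hv⟩).ne (hadd u v)
  · intro c u hu
    have heq : e (c • u) = ‖c‖ₑ * e u := by
      rcases eq_or_ne c 0 with rfl | hc
      · simp [h0]
      refine le_antisymm (hsmul c u) ?_
      have h1 := hsmul c⁻¹ (c • u)
      rw [smul_smul, inv_mul_cancel₀ hc, one_smul] at h1
      calc ‖c‖ₑ * e u ≤ ‖c‖ₑ * (‖c⁻¹‖ₑ * e (c • u)) := by gcongr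
        _ = e (c • u) := by
          rw [← mul_assoc, ← enorm_mul, mul_inv_cancel₀ hc]
          simp
    simp [heq, ENNReal.toReal_mul]
  · intro s hs hc
    -- A Cauchy sequence has a subsequence `s (N k)` whose increments `d k` satisfy `e (d k) ≤ 2⁻ᵏ`.
    have hc' : ∀ k : ℕ, ∃ n₀, ∀ n ≥ n₀, ∀ m ≥ n₀, e (s n - s m) ≤ (2⁻¹ : ℝ≥0∞) ^ k := by
      intro k
      obtain ⟨n₀, h⟩ := hc ((2⁻¹ : ℝ) ^ k) (by positivity)
      refine ⟨n₀, fun n hn m hm => ?_⟩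
      have h1 := (h n hn m hm).le
      rw [← ENNReal.ofReal_toReal (hsubmem (hs n) (hs m)).ne]
      refine (ENNReal.ofReal_le_ofReal h1).trans (le_of_eq ?_)
      rw [ENNReal.ofReal_pow (by norm_num), ENNReal.ofReal_inv_of_pos (by norm_num)]
      simp
    choose N' hN' using hc'
    let N : ℕ → ℕ := fun k => ∑ i ∈ Finset.range (k + 1), N' i
    have hNN' : ∀ k, N' k ≤ N k := fun k =>
      Finset.single_le_sum (f := N') (fun _ _ => Nat.zero_le _) (Finset.mem_range.2 k.lt_succ_self)
    have hNmono : ∀ k, N k ≤ N (k + 1) := fun k => by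
      simp only [N, Finset.sum_range_succ _ (k + 1)]; omega
    let d : ℕ → C₀(G, ℂ) := fun k => s (N (k + 1)) - s (N k)
    have hd : ∀ k, e (d k) ≤ (2⁻¹ : ℝ≥0∞) ^ k := fun k =>
      hN' k _ ((hNN' k).trans (hNmono k)) _ (hNN' k)
    have hgeo : ∀ K : ℕ, ∑' k, (2⁻¹ : ℝ≥0∞) ^ (k + K) = 2 * 2⁻¹ ^ K := fun K => by
      simp_rw [pow_add]
      rw [ENNReal.tsum_mul_right, ENNReal.tsum_geometric, ENNReal.one_sub_inv_two, inv_inv]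
    have hdsum : Summable d := by
      refine summable_of_tsum_enorm_lt_top
        ((ENNReal.tsum_le_tsum fun k => (hle _).trans (hd k)).trans_lt ?_)
      have := hgeo 0
      simp only [add_zero, pow_zero, mul_one] at this
      rw [this]
      simp
    set w := ∑' k, d k with hw
    set v := s (N 0) + w with hv
    have htail : ∀ K, e (v - s (N K)) ≤ 2 * 2⁻¹ ^ K := fun K => by
      have h1 : HasSum (fun k => d (k + K)) (v - s (N K)) := by
        rw [hasSum_nat_add_iff K, Finset.sum_range_sub (fun k => s (N k))]
        have h2 : v - s (N K) + (s (N K) - s (N 0)) = w := by rw [hv]; abel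
        rw [h2]
        exact hdsum.hasSum
      exact (htsum h1).trans ((ENNReal.tsum_le_tsum fun k => hd _).trans (hgeo K).le)
    have hvmem : e v < ∞ := by
      have h1 := hadd (v - s (N 0)) (s (N 0))
      rw [sub_add_cancel] at h1
      refine h1.trans_lt (ENNReal.add_lt_top.2 ⟨(htail 0).trans_lt (by simp), hs _⟩)
    refine ⟨v, hvmem, ?_⟩
    have hlim : Tendsto (fun n => e (s n - v)) atTop (𝓝 0) := by
      have h3 : Tendsto (fun K : ℕ => 3 * (2⁻¹ : ℝ≥0∞) ^ K) atTop (𝓝 0) := by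
        have := ENNReal.Tendsto.const_mul (a := 3)
          (ENNReal.tendsto_pow_atTop_nhds_zero_of_lt_one (r := 2⁻¹) (by simp)) (Or.inr (by simp))
        simpa using this
      rw [ENNReal.tendsto_nhds_zero] at h3 ⊢
      intro ε hε
      obtain ⟨K, hK⟩ := (h3 ε hε).exists
      filter_upwards [eventually_ge_atTop (N K)] with n hn
      refine le_trans ?_ hK
      have h4 := hN' K n ((hNN' K).trans hn) (N K) (hNN' K)
      have h5 : e (s (N K) - v) ≤ 2 * 2⁻¹ ^ K := by
        have := hneg (v - s (N K))
        rw [neg_sub] at this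
        exact this.trans (htail K)
      calc e (s n - v) ≤ e (s n - s (N K)) + e (s (N K) - v) := hsub _ _ _
        _ ≤ 2⁻¹ ^ K + 2 * 2⁻¹ ^ K := add_le_add h4 h5
        _ = 3 * 2⁻¹ ^ K := by ring
    exact (ENNReal.tendsto_toReal (by simp : (0 : ℝ≥0∞) ≠ ∞)).comp hlim

variable [MeasurableSpace G] [Group G] [IsTopologicalGroup G] [BorelSpace G] {μ : Measure G}
  [μ.IsMulLeftInvariant] {Φ : ℝ → ℝ}

theorem IsNFunction.isBanachSubspace_aPhi (h : IsNFunction Φ) :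
    IsBanachSubspace (APhi Φ μ) (aPhiNorm Φ μ) := by
  have hA : APhi Φ μ = {u | aPhiENorm Φ μ u < ∞} := Set.ext fun u => mem_aPhi_iff
  rw [hA]
  exact isBanachSubspace_of_tsum_le h.enorm_le_aPhiENorm h.aPhiENorm_smul_le h.aPhiENorm_le_tsum

end Banach

/-! ### Convolution on compact groups -/

section Compact

lemma norm_integral_mul_le_of_bound {X : Type*} [MeasurableSpace X] {μ : Measure X} {a b : X → ℂ}
    {K : ℝ} (ha : ∀ x, ‖a x‖ ≤ K) (hb : Integrable b μ) :
    ‖∫ x, a x * b x ∂μ‖ ≤ K * ∫ x, ‖b x‖ ∂μ := by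
  rw [← integral_const_mul]
  refine norm_integral_le_of_norm_le (hb.norm.const_mul K) (Eventually.of_forall fun x => ?_)
  rw [norm_mul]
  exact mul_le_mul_of_nonneg_right (ha x) (norm_nonneg _)

variable {G : Type*} [MeasurableSpace G] [Group G] [TopologicalSpace G]
  [IsTopologicalGroup G] [BorelSpace G] [CompactSpace G] {μ : Measure G} [μ.IsHaarMeasure]

lemma exists_norm_le_of_continuous {X : Type*} [TopologicalSpace X] [CompactSpace X] {f : X → ℂ}
    (hf : Continuous f) : ∃ K : ℝ, 0 ≤ K ∧ ∀ x, ‖f x‖ ≤ K := by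
  obtain ⟨K, hK⟩ := isCompact_univ.exists_bound_of_continuousOn hf.continuousOn
  exact ⟨max K 0, le_max_right _ _, fun x => (hK x (Set.mem_univ x)).trans (le_max_left _ _)⟩

lemma integrable_of_continuous {f : G → ℂ} (hf : Continuous f) : Integrable f μ :=
  hf.integrable_of_hasCompactSupport (HasCompactSupport.of_compactSpace f)

lemma isMulRightInvariant_of_compactSpace : μ.IsMulRightInvariant := by
  refine ⟨fun g => ?_⟩
  have h := Measure.isMulInvariant_eq_smul_of_compactSpace (μ.map (· * g)) μ
  have h1 : (μ.map (· * g)) Set.univ = μ Set.univ := by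
    rw [Measure.map_apply (measurable_mul_const g) MeasurableSet.univ, Set.preimage_univ]
  rw [h] at h1 ⊢
  rw [Measure.smul_apply, ENNReal.smul_def, smul_eq_mul] at h1
  have h2 := ENNReal.mul_eq_right (IsOpen.measure_ne_zero μ isOpen_univ ⟨1, trivial⟩)
    (measure_ne_top μ _) |>.1 h1
  rw [ENNReal.coe_eq_one.1 h2, one_smul]

lemma isInvInvariant_of_compactSpace : μ.IsInvInvariant := by
  have : μ.IsMulRightInvariant := isMulRightInvariant_of_compactSpace
  refine ⟨?_⟩
  have h := Measure.isMulInvariant_eq_smul_of_compactSpace μ.inv μ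
  have h1 : μ.inv Set.univ = μ Set.univ := by simp [Measure.inv_apply]
  rw [h] at h1 ⊢
  rw [Measure.smul_apply, ENNReal.smul_def, smul_eq_mul] at h1
  have h2 := ENNReal.mul_eq_right (IsOpen.measure_ne_zero μ isOpen_univ ⟨1, trivial⟩)
    (measure_ne_top μ _) |>.1 h1
  rw [ENNReal.coe_eq_one.1 h2, one_smul]

variable [μ.IsMulRightInvariant] [μ.IsInvInvariant]

lemma integrable_comp_inv_mul {f : G → ℂ} (hf : Integrable f μ) (x : G) :
    Integrable (fun y => f (y⁻¹ * x)) μ :=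
  (hf.comp_mul_right x).comp_inv

lemma integral_norm_comp_inv_mul (f : G → ℂ) (x : G) :
    ∫ y, ‖f (y⁻¹ * x)‖ ∂μ = ∫ y, ‖f y‖ ∂μ := by
  rw [integral_inv_eq_self (fun y => ‖f (y * x)‖), integral_mul_right_eq_self (fun y => ‖f y‖)]

lemma continuous_integral_mul_comp {X : Type*} [TopologicalSpace X] {k : X → G → ℂ}
    (hk : Continuous k.uncurry) {g : G → ℂ} (hg : Integrable g μ) :
    Continuous fun x => ∫ y, k x y * g y ∂μ := by
  have := continuousOn_integral_bilinear_of_locally_integrable_of_compact_support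
    (μ := μ) (ContinuousLinearMap.mul ℝ ℂ) (f := k) (s := Set.univ) (k := Set.univ) (g := g)
    isCompact_univ hk.continuousOn (fun p x _ hx => absurd (Set.mem_univ x) hx) hg.integrableOn
  rw [continuousOn_univ] at this
  simpa [mul_comm] using this

lemma continuous_conv_left {u f : G → ℂ} (hu : Continuous u) (hf : Integrable f μ) :
    Continuous (conv μ u f) := by
  have h1 : conv μ u f = fun x => ∫ y, u (x * y) * f y⁻¹ ∂μ := by
    funext x
    rw [conv, ← integral_mul_left_eq_self _ x]
    simp
  rw [h1]
  exact continuous_integral_mul_comp (k := fun x y => u (x * y)) (hu.comp continuous_mul) hf.comp_inv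

lemma norm_conv_le {u f : G → ℂ} {U : ℝ} (hU : ∀ x, ‖u x‖ ≤ U) (hf : Integrable f μ) (x : G) :
    ‖conv μ u f x‖ ≤ U * ∫ y, ‖f y‖ ∂μ := by
  rw [← integral_norm_comp_inv_mul f x]
  exact norm_integral_mul_le_of_bound hU (integrable_comp_inv_mul hf x)

lemma conv_sub_right {u f f' : G → ℂ} (hu : Continuous u) (hf : Integrable f μ)
    (hf' : Integrable f' μ) (x : G) :
    conv μ u f x - conv μ u f' x = conv μ u (fun y => f y - f' y) x := by
  obtain ⟨U, -, hU⟩ := exists_norm_le_of_continuous hu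
  have h : ∀ {g : G → ℂ}, Integrable g μ → Integrable (fun y => u y * g (y⁻¹ * x)) μ := fun hg =>
    (integrable_comp_inv_mul hg x).bdd_mul hu.aestronglyMeasurable (Eventually.of_forall hU)
  simp only [conv]
  rw [← integral_sub (h hf) (h hf')]
  simp only [mul_sub]

lemma exists_seq_continuous_tendsto {f : G → ℂ} (hf : Integrable f μ) :
    ∃ c : ℕ → G → ℂ, (∀ n, Continuous (c n)) ∧
      Tendsto (fun n => ∫ x, ‖f x - c n x‖ ∂μ) atTop (𝓝 0) := by
  have h : ∀ n : ℕ, ∃ c : G → ℂ, Continuous c ∧ ∫ x, ‖f x - c x‖ ∂μ ≤ 1 / ((n : ℝ) + 1) := fun n => by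
    obtain ⟨c, -, hc, hcc, -⟩ := hf.exists_hasCompactSupport_integral_sub_le
      (ε := 1 / ((n : ℝ) + 1)) (by positivity)
    exact ⟨c, hcc, hc⟩
  choose c hc hle using h
  exact ⟨c, hc, squeeze_zero (fun n => integral_nonneg fun x => norm_nonneg _) hle
    tendsto_one_div_add_atTop_nhds_zero_nat⟩

lemma tendsto_of_norm_sub_le_mul {a : ℂ} {b : ℕ → ℂ} {K : ℝ} {δ : ℕ → ℝ}
    (hδ : Tendsto δ atTop (𝓝 0)) (h : ∀ n, ‖a - b n‖ ≤ K * δ n) : Tendsto b atTop (𝓝 a) := by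
  rw [tendsto_iff_norm_sub_tendsto_zero]
  refine squeeze_zero (fun n => norm_nonneg _) (fun n => ?_) (by simpa using hδ.const_mul K)
  rw [norm_sub_rev]
  exact h n

/-- For integrable `f` and bounded `g`, the function `f * ǧ` is continuous: it is the uniform limit of
the functions `cₙ * ǧ` with `cₙ` continuous and `cₙ → f` in `L¹`. -/
lemma continuous_conv_check_of_bounded {f g : G → ℂ} (hf : Integrable f μ)
    (hg : AEStronglyMeasurable g μ) {M : ℝ} (hM : ∀ x, ‖g x‖ ≤ M) :
    Continuous (conv μ f (check g)) := by
  obtain ⟨c, hc, hlim⟩ := exists_seq_continuous_tendsto hf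
  have hgi : Integrable g μ := Integrable.of_bound hg M (Eventually.of_forall hM)
  have hcont : ∀ n, Continuous (conv μ (c n) (check g)) := fun n => by
    have : conv μ (c n) (check g) = fun x => ∫ y, c n (x * y) * g y ∂μ :=
      funext fun x => conv_check_eq _ _ _
    rw [this]
    exact continuous_integral_mul_comp (k := fun x y => c n (x * y)) ((hc n).comp continuous_mul)
      hgi
  have hdiff : ∀ n x, ‖conv μ f (check g) x - conv μ (c n) (check g) x‖ ≤
      M * ∫ y, ‖f y - c n y‖ ∂μ := fun n x => by
    have hi := hf.sub (integrable_of_continuous (μ := μ) (hc n))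
    simp only [conv_check_eq]
    rw [← integral_sub]
    · have := norm_integral_mul_le_of_bound hM (hi.comp_mul_left x)
      rw [integral_mul_left_eq_self (fun y => ‖(f - c n) y‖)] at this
      simpa [mul_sub, mul_comm] using this
    · exact (hf.comp_mul_left x).mul_bdd hg (Eventually.of_forall hM)
    · exact ((integrable_of_continuous (μ := μ) (hc n)).comp_mul_left x).mul_bdd hg
        (Eventually.of_forall hM)
  have hunif : TendstoUniformly (fun n => conv μ (c n) (check g)) (conv μ f (check g)) atTop := by
    rw [Metric.tendstoUniformly_iff]
    intro ε hε
    have h0 : Tendsto (fun n => M * ∫ y, ‖f y - c n y‖ ∂μ) atTop (𝓝 0) := by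
      simpa using hlim.const_mul M
    filter_upwards [h0.eventually_lt_const hε] with n hn x
    rw [dist_eq_norm]
    exact (hdiff n x).trans_lt hn
  exact hunif.continuous (Eventually.of_forall hcont).frequently

lemma conv_check_assoc_of_continuous {u f g : G → ℂ} (hu : Continuous u) (hf : Continuous f)
    (hg : Continuous g) (x : G) :
    ∫ z, conv μ u f (x * z) * g z ∂μ = ∫ y, u y * conv μ f (check g) (y⁻¹ * x) ∂μ := by
  have h1 : ∀ z, conv μ u f (x * z) * g z = ∫ y, u y * f (y⁻¹ * x * z) * g z ∂μ := fun z => by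
    rw [integral_mul_const, conv]
    simp only [mul_assoc]
  have h2 : ∀ y, u y * conv μ f (check g) (y⁻¹ * x) = ∫ z, u y * f (y⁻¹ * x * z) * g z ∂μ :=
    fun y => by
      rw [conv_check_eq, ← integral_const_mul]
      simp only [mul_assoc]
  simp only [h1, h2]
  refine integral_integral_swap_of_hasCompactSupport (f := fun z y => u y * f (y⁻¹ * x * z) * g z)
    ?_ (HasCompactSupport.of_compactSpace _)
  simp only [Function.uncurry_def]
  fun_prop

lemma conv_check_assoc_of_continuous_of_integrable {u f g : G → ℂ} (hu : Continuous u)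
    (hf : Continuous f) (hg : Integrable g μ) (x : G) :
    ∫ z, conv μ u f (x * z) * g z ∂μ = ∫ y, u y * conv μ f (check g) (y⁻¹ * x) ∂μ := by
  obtain ⟨c, hc, hlim⟩ := exists_seq_continuous_tendsto hg
  have hci : ∀ n, Integrable (c n) μ := fun n => integrable_of_continuous (hc n)
  have hF := continuous_conv_left hu (integrable_of_continuous (μ := μ) hf)
  obtain ⟨K, hK0, hK⟩ := exists_norm_le_of_continuous hF
  obtain ⟨U, hU0, hU⟩ := exists_norm_le_of_continuous hu
  obtain ⟨M, hM0, hM⟩ := exists_norm_le_of_continuous hf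
  have hl : Tendsto (fun n => ∫ z, conv μ u f (x * z) * c n z ∂μ) atTop
      (𝓝 (∫ z, conv μ u f (x * z) * g z ∂μ)) := by
    refine tendsto_of_norm_sub_le_mul (K := K) hlim fun n => ?_
    have hFx : Continuous fun z => conv μ u f (x * z) := hF.comp (continuous_const_mul x)
    have hb : ∀ᵐ z ∂μ, ‖conv μ u f (x * z)‖ ≤ K := Eventually.of_forall fun z => hK _
    rw [← integral_sub (hg.bdd_mul hFx.aestronglyMeasurable hb)
      ((hci n).bdd_mul hFx.aestronglyMeasurable hb)]
    simpa [mul_sub] using norm_integral_mul_le_of_bound (fun z => hK (x * z)) (hg.sub (hci n))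
  have hB : ∀ {h : G → ℂ}, Integrable h μ → Continuous (conv μ f (check h)) := fun {h} hh => by
    have : conv μ f (check h) = fun x => ∫ y, f (x * y) * h y ∂μ :=
      funext fun x => conv_check_eq _ _ _
    rw [this]
    exact continuous_integral_mul_comp (k := fun x y => f (x * y)) (hf.comp continuous_mul) hh
  have hr : Tendsto (fun n => ∫ y, u y * conv μ f (check (c n)) (y⁻¹ * x) ∂μ) atTop
      (𝓝 (∫ y, u y * conv μ f (check g) (y⁻¹ * x) ∂μ)) := by
    refine tendsto_of_norm_sub_le_mul (K := U * M * μ.real Set.univ) hlim fun n => ?_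
    have hi : ∀ {h : G → ℂ}, Integrable h μ →
        Integrable (fun y => u y * conv μ f (check h) (y⁻¹ * x)) μ := fun hh =>
      integrable_of_continuous (hu.mul ((hB hh).comp (by fun_prop)))
    rw [← integral_sub (hi hg) (hi (hci n))]
    refine (norm_integral_le_of_norm_le_const (C := U * (M * ∫ z, ‖g z - c n z‖ ∂μ))
      (Eventually.of_forall fun y => ?_)).trans (le_of_eq (by ring))
    rw [← mul_sub, norm_mul]
    refine mul_le_mul (hU y) ?_ (norm_nonneg _) hU0
    simp only [conv_check_eq]
    have hfy : Continuous fun z => f (y⁻¹ * x * z) := hf.comp (continuous_const_mul _)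
    have hb : ∀ᵐ z ∂μ, ‖f (y⁻¹ * x * z)‖ ≤ M := Eventually.of_forall fun z => hM _
    rw [← integral_sub (hg.bdd_mul hfy.aestronglyMeasurable hb)
      ((hci n).bdd_mul hfy.aestronglyMeasurable hb)]
    simpa [mul_sub] using
      norm_integral_mul_le_of_bound (fun z => hM (y⁻¹ * x * z)) (hg.sub (hci n))
  refine tendsto_nhds_unique hl (hr.congr fun n => ?_)
  exact (conv_check_assoc_of_continuous hu hf (hc n) x).symm

lemma conv_check_assoc_of_bounded {u f g : G → ℂ} (hu : Continuous u)
    (hf : Integrable f μ) (hg : AEStronglyMeasurable g μ) {M : ℝ} (hM : ∀ x, ‖g x‖ ≤ M) (x : G) :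
    ∫ z, conv μ u f (x * z) * g z ∂μ = ∫ y, u y * conv μ f (check g) (y⁻¹ * x) ∂μ := by
  obtain ⟨c, hc, hlim⟩ := exists_seq_continuous_tendsto hf
  have hci : ∀ n, Integrable (c n) μ := fun n => integrable_of_continuous (hc n)
  have hgi : Integrable g μ := Integrable.of_bound hg M (Eventually.of_forall hM)
  obtain ⟨U, hU0, hU⟩ := exists_norm_le_of_continuous hu
  have hl : Tendsto (fun n => ∫ z, conv μ u (c n) (x * z) * g z ∂μ) atTop
      (𝓝 (∫ z, conv μ u f (x * z) * g z ∂μ)) := by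
    refine tendsto_of_norm_sub_le_mul (K := U * ∫ z, ‖g z‖ ∂μ) hlim fun n => ?_
    have hi : ∀ {h : G → ℂ}, Integrable h μ →
        Integrable (fun z => conv μ u h (x * z) * g z) μ := fun {h} hh => by
      have hF := continuous_conv_left hu hh
      obtain ⟨K, -, hK⟩ := exists_norm_le_of_continuous hF
      exact hgi.bdd_mul (hF.comp (continuous_const_mul x)).aestronglyMeasurable
        (Eventually.of_forall fun z => hK _)
    rw [← integral_sub (hi hf) (hi (hci n))]
    simp only [← sub_mul, conv_sub_right hu hf (hci n)]
    refine (norm_integral_mul_le_of_bound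
      (fun z => norm_conv_le hU (hf.sub (hci n)) (x * z)) hgi).trans (le_of_eq ?_)
    simp only [Pi.sub_apply]
    ring
  have hr : Tendsto (fun n => ∫ y, u y * conv μ (c n) (check g) (y⁻¹ * x) ∂μ) atTop
      (𝓝 (∫ y, u y * conv μ f (check g) (y⁻¹ * x) ∂μ)) := by
    refine tendsto_of_norm_sub_le_mul (K := U * M * μ.real Set.univ) hlim fun n => ?_
    have hi : ∀ {h : G → ℂ}, Integrable h μ →
        Integrable (fun y => u y * conv μ h (check g) (y⁻¹ * x)) μ := fun hh =>
      integrable_of_continuous (hu.mul ((continuous_conv_check_of_bounded hh hg hM).comp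
        (by fun_prop)))
    rw [← integral_sub (hi hf) (hi (hci n))]
    refine (norm_integral_le_of_norm_le_const (C := U * (M * ∫ z, ‖f z - c n z‖ ∂μ))
      (Eventually.of_forall fun y => ?_)).trans (le_of_eq (by ring))
    rw [← mul_sub, norm_mul]
    refine mul_le_mul (hU y) ?_ (norm_nonneg _) hU0
    simp only [conv_check_eq]
    have hb : ∀ᵐ z ∂μ, ‖g z‖ ≤ M := Eventually.of_forall hM
    rw [← integral_sub ((hf.comp_mul_left _).mul_bdd hg hb)
      (((hci n).comp_mul_left _).mul_bdd hg hb)]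
    have := norm_integral_mul_le_of_bound hM ((hf.sub (hci n)).comp_mul_left (y⁻¹ * x))
    rw [integral_mul_left_eq_self (fun z => ‖(f - c n) z‖)] at this
    simpa [mul_sub, mul_comm] using this
  refine tendsto_nhds_unique hl (hr.congr fun n => ?_)
  exact (conv_check_assoc_of_continuous_of_integrable hu (hc n) hgi x).symm

variable {Φ : ℝ → ℝ}

omit [μ.IsMulRightInvariant] [μ.IsInvInvariant] in
lemma one_mem_morseTransue {F : ℝ → ℝ} (hF0 : F 0 = 0)
    (hF : ∀ x y : ℝ, 0 ≤ x → x ≤ y → F x ≤ F y) : (fun _ : G => (1 : ℂ)) ∈ morseTransue F μ :=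
  mem_morseTransue_of_bounded hF0 hF aestronglyMeasurable_const (measure_ne_top μ Set.univ)
    (fun x hx => absurd (Set.mem_univ x) hx) (C := 1) (fun x => by simp)

omit [μ.IsMulRightInvariant] [μ.IsInvInvariant] in
lemma IsNFunction.lintegral_enorm_le (h : IsNFunction Φ) {f : G → ℂ} (hf : f ∈ morseTransue Φ μ) :
    ∫⁻ x, ‖f x‖ₑ ∂μ ≤
      luxemburgNorm Φ μ f * orliczNorm (complementary Φ) μ (fun _ : G => (1 : ℂ)) := by
  simpa using h.lintegral_enorm_mul_le hf
    (one_mem_morseTransue h.complementary_zero fun x y hx hxy => h.complementary_mono hx hxy)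

omit [μ.IsMulRightInvariant] [μ.IsInvInvariant] in
lemma IsNFunction.integrable_left (h : IsNFunction Φ) {f : G → ℂ} (hf : f ∈ morseTransue Φ μ) :
    Integrable f μ :=
  ⟨hf.1, (h.lintegral_enorm_le hf).trans_lt (ENNReal.mul_lt_top (h.luxemburgNorm_lt_top_of_mem hf)
    (h.orliczNorm_complementary_lt_top (one_mem_morseTransue h.complementary_zero
      fun _ _ hx hxy => h.complementary_mono hx hxy)))⟩

omit [μ.IsMulRightInvariant] [μ.IsInvInvariant] in
lemma IsNFunction.integrable_right (h : IsNFunction Φ) {g : G → ℂ}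
    (hg : g ∈ morseTransue (complementary Φ) μ) : Integrable g μ := by
  have h1 : (fun _ : G => (1 : ℂ)) ∈ morseTransue Φ μ :=
    one_mem_morseTransue h.map_zero fun _ _ hx hxy => h.mono hx hxy
  simpa using h.integrable_translate_mul h1 hg 1

/-- The truncations of `g` at height `n` give continuous functions `f * ǧₙ` converging pointwise to
`f * ǧ`. -/
lemma IsNFunction.tendsto_conv_truncation (h : IsNFunction Φ) {f g : G → ℂ}
    (hf : f ∈ morseTransue Φ μ) (hg : g ∈ morseTransue (complementary Φ) μ) :
    ∃ t : ℕ → G → ℂ, (∀ n, AEStronglyMeasurable (t n) μ) ∧ (∀ n x, ‖t n x‖ ≤ n) ∧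
      (∀ n x, ‖t n x‖ ≤ ‖g x‖) ∧ (∀ x, Tendsto (fun n => t n x) atTop (𝓝 (g x))) ∧
      ∀ x, Tendsto (fun n => conv μ f (check (t n)) x) atTop (𝓝 (conv μ f (check g) x)) := by
  set t : ℕ → G → ℂ := fun n => {x | ‖g x‖ ≤ n}.indicator g with ht
  have hm : ∀ n, AEStronglyMeasurable (t n) μ := fun n =>
    hg.1.indicator₀ (nullMeasurableSet_le hg.1.norm.aemeasurable aemeasurable_const)
  have hle : ∀ n x, ‖t n x‖ ≤ ‖g x‖ := fun n x => norm_indicator_le_norm_self g x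
  have hlim : ∀ x, Tendsto (fun n => t n x) atTop (𝓝 (g x)) := fun x => by
    obtain ⟨N, hN⟩ := exists_nat_ge ‖g x‖
    refine tendsto_const_nhds.congr' ?_
    filter_upwards [eventually_ge_atTop N] with n hn
    have : x ∈ {x | ‖g x‖ ≤ n} := hN.trans (by exact_mod_cast hn)
    exact (Set.indicator_of_mem this g).symm
  refine ⟨t, hm, fun n x => ?_, hle, hlim, fun x => ?_⟩
  · by_cases hx : ‖g x‖ ≤ n
    · exact (hle n x).trans hx
    · have : x ∉ {x | ‖g x‖ ≤ n} := hx
      simp [ht, Set.indicator_of_notMem this]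
  · simp only [conv_check_eq]
    have hi := h.integrable_translate_mul hf hg x
    refine tendsto_integral_of_dominated_convergence (fun y => ‖f (x * y) * g y‖)
      (fun n => (translate_mem_morseTransue hf x).1.mul (hm n)) hi.norm (fun n => ?_) ?_
    · refine Eventually.of_forall fun y => ?_
      rw [norm_mul, norm_mul]
      exact mul_le_mul_of_nonneg_left (hle n y) (norm_nonneg _)
    · exact Eventually.of_forall fun y => (hlim y).const_mul _

lemma IsNFunction.aestronglyMeasurable_conv_check (h : IsNFunction Φ) {f g : G → ℂ}
    (hf : f ∈ morseTransue Φ μ) (hg : g ∈ morseTransue (complementary Φ) μ) (x : G) :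
    AEStronglyMeasurable (fun y => conv μ f (check g) (y⁻¹ * x)) μ := by
  obtain ⟨t, hm, hn, -, -, hlim⟩ := h.tendsto_conv_truncation hf hg
  refine aestronglyMeasurable_of_tendsto_ae atTop
    (f := fun n y => conv μ f (check (t n)) (y⁻¹ * x)) (fun n => ?_)
    (Eventually.of_forall fun y => hlim _)
  exact ((continuous_conv_check_of_bounded (h.integrable_left hf) (hm n) (hn n)).comp
    (by fun_prop)).aestronglyMeasurable

lemma IsNFunction.norm_conv_check_le (h : IsNFunction Φ) {f g : G → ℂ}
    (hf : f ∈ morseTransue Φ μ) (hg : g ∈ morseTransue (complementary Φ) μ) (x : G) :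
    ‖conv μ f (check g) x‖ ≤
      (luxemburgNorm Φ μ f * orliczNorm (complementary Φ) μ g).toReal := by
  rw [← toReal_enorm]
  exact ENNReal.toReal_mono (ENNReal.mul_lt_top (h.luxemburgNorm_lt_top_of_mem hf)
    (h.orliczNorm_complementary_lt_top hg)).ne (h.enorm_conv_le hf hg x)

/-- The associative law `(u * f) * ǧ = u * (f * ǧ)`. Since the Borel `σ`-algebra of `G × G` need not
be the product `σ`-algebra, Fubini's theorem is applied to continuous functions only, and `f` and `g`
are reached by approximation. -/
lemma IsNFunction.conv_check_assoc (h : IsNFunction Φ) {u f g : G → ℂ} (hu : Continuous u)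
    (hf : f ∈ morseTransue Φ μ) (hg : g ∈ morseTransue (complementary Φ) μ) (x : G) :
    conv μ (conv μ u f) (check g) x = conv μ u (conv μ f (check g)) x := by
  obtain ⟨t, hm, hn, hle, hgt, hlim⟩ := h.tendsto_conv_truncation hf hg
  have hfi := h.integrable_left hf
  have hgi := h.integrable_right hg
  have hF := continuous_conv_left hu hfi
  obtain ⟨K, hK0, hK⟩ := exists_norm_le_of_continuous hF
  obtain ⟨U, hU0, hU⟩ := exists_norm_le_of_continuous hu
  rw [conv_check_eq]
  have hFx : Continuous fun z => conv μ u f (x * z) := hF.comp (continuous_const_mul x)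
  have hl : Tendsto (fun n => ∫ z, conv μ u f (x * z) * t n z ∂μ) atTop
      (𝓝 (∫ z, conv μ u f (x * z) * g z ∂μ)) := by
    refine tendsto_integral_of_dominated_convergence (fun z => K * ‖g z‖)
      (fun n => hFx.aestronglyMeasurable.mul (hm n)) (hgi.norm.const_mul K) (fun n => ?_) ?_
    · refine Eventually.of_forall fun z => ?_
      rw [norm_mul]
      exact mul_le_mul (hK _) (hle n z) (norm_nonneg _) hK0
    · exact Eventually.of_forall fun z => (hgt z).const_mul _
  have hr : Tendsto (fun n => ∫ y, u y * conv μ f (check (t n)) (y⁻¹ * x) ∂μ) atTop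
      (𝓝 (∫ y, u y * conv μ f (check g) (y⁻¹ * x) ∂μ)) := by
    refine tendsto_integral_of_dominated_convergence
      (fun _ => U * (luxemburgNorm Φ μ f * orliczNorm (complementary Φ) μ g).toReal)
      (fun n => hu.aestronglyMeasurable.mul
        ((continuous_conv_check_of_bounded hfi (hm n) (hn n)).comp
          (by fun_prop)).aestronglyMeasurable) (integrable_const _) (fun n => ?_) ?_
    · refine Eventually.of_forall fun y => ?_
      rw [norm_mul]
      refine mul_le_mul (hU y) ?_ (norm_nonneg _) hU0
      rw [conv_check_eq, ← toReal_enorm]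
      refine ENNReal.toReal_mono (ENNReal.mul_lt_top (h.luxemburgNorm_lt_top_of_mem hf)
        (h.orliczNorm_complementary_lt_top hg)).ne ?_
      refine (enorm_integral_le_lintegral_enorm _).trans
        (le_trans (lintegral_mono fun z => ?_) (h.lintegral_translate_le hf hg (y⁻¹ * x)))
      rw [enorm_mul, enorm_mul]
      gcongr
      exact enorm_le_iff_norm_le.2 (hle n z)
    · exact Eventually.of_forall fun y => (hlim _).const_mul _
  refine tendsto_nhds_unique hl (hr.congr fun n => ?_)
  exact (conv_check_assoc_of_bounded hu hfi (hm n) (hn n) x).symm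

omit [μ.IsMulRightInvariant] [μ.IsInvInvariant] in
lemma IsNFunction.luxemburgNorm_le_mul_one (h : IsNFunction Φ) {F : G → ℂ} {c : ℝ≥0∞} (hc : c ≠ ∞)
    (hF : ∀ x, ‖F x‖ₑ ≤ c) :
    luxemburgNorm Φ μ F ≤ c * luxemburgNorm Φ μ (fun _ : G => (1 : ℂ)) := by
  have h1 := luxemburgNorm_const_mul_le (μ := μ) (Φ := Φ) (c.toReal : ℂ) (fun _ : G => (1 : ℂ))
    h.map_zero
  have h2 : ‖(c.toReal : ℂ)‖ₑ = c := by
    rw [← ofReal_norm, Complex.norm_real, Real.norm_of_nonneg ENNReal.toReal_nonneg,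
      ENNReal.ofReal_toReal hc]
  rw [h2] at h1
  refine le_trans ?_ h1
  refine le_iInf fun k => le_iInf fun hk => le_iInf fun hm => luxemburgNorm_le_ofReal hk ?_
  refine (lintegral_mono fun x => ENNReal.ofReal_le_ofReal (h.mono (norm_nonneg _) ?_)).trans hm
  rw [norm_div, norm_div]
  gcongr
  rw [mul_one]
  refine enorm_le_iff_norm_le.1 ?_
  rw [h2]
  exact hF x

omit [μ.IsMulRightInvariant] [μ.IsInvInvariant] in
lemma IsNFunction.luxemburgNorm_one_mul_orliczNorm_one_lt_top (h : IsNFunction Φ) :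
    luxemburgNorm Φ μ (fun _ : G => (1 : ℂ)) *
      orliczNorm (complementary Φ) μ (fun _ : G => (1 : ℂ)) < ∞ :=
  ENNReal.mul_lt_top
    (h.luxemburgNorm_lt_top_of_mem (one_mem_morseTransue h.map_zero fun _ _ hx hxy => h.mono hx hxy))
    (h.orliczNorm_complementary_lt_top (one_mem_morseTransue h.complementary_zero
      fun _ _ hx hxy => h.complementary_mono hx hxy))

lemma IsNFunction.conv_mem_morseTransue (h : IsNFunction Φ) {u f : G → ℂ} (hu : Continuous u)
    (hf : f ∈ morseTransue Φ μ) : conv μ u f ∈ morseTransue Φ μ := by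
  have hF := continuous_conv_left hu (h.integrable_left hf)
  obtain ⟨K, -, hK⟩ := exists_norm_le_of_continuous hF
  exact mem_morseTransue_of_bounded h.map_zero (fun x y hx hxy => h.mono hx hxy)
    hF.aestronglyMeasurable (measure_ne_top μ Set.univ) (fun x hx => absurd (Set.mem_univ x) hx) hK

/-- On a compact group `N_Φ(u * f) ≤ C ‖u‖_∞ N_Φ(f)`, because `|u * f| ≤ ‖u‖_∞ ‖f‖_1`. -/
lemma IsNFunction.luxemburgNorm_conv_le (h : IsNFunction Φ) (u : C₀(G, ℂ)) {f : G → ℂ}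
    (hf : f ∈ morseTransue Φ μ) :
    luxemburgNorm Φ μ (conv μ u f) ≤ (luxemburgNorm Φ μ (fun _ : G => (1 : ℂ)) *
      orliczNorm (complementary Φ) μ (fun _ : G => (1 : ℂ))) * ‖u‖ₑ * luxemburgNorm Φ μ f := by
  have hfi := h.integrable_left hf
  have hF : ∀ x, ‖conv μ u f x‖ₑ ≤ ‖u‖ₑ * ∫⁻ y, ‖f y‖ₑ ∂μ := fun x => by
    have h1 := norm_conv_le (norm_apply_le u) hfi x
    rw [← ofReal_norm, ← ofReal_norm, ← ofReal_integral_norm_eq_lintegral_enorm hfi,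
      ← ENNReal.ofReal_mul (norm_nonneg _)]
    exact ENNReal.ofReal_le_ofReal h1
  refine (h.luxemburgNorm_le_mul_one (ENNReal.mul_lt_top enorm_lt_top hfi.2).ne hF).trans ?_
  calc _ ≤ ‖u‖ₑ * (luxemburgNorm Φ μ f * orliczNorm (complementary Φ) μ (fun _ : G => (1 : ℂ))) *
        luxemburgNorm Φ μ (fun _ : G => (1 : ℂ)) := by
        gcongr
        exact h.lintegral_enorm_le hf
    _ = _ := by ring

/-- On a compact group `‖u * v‖_{A_Φ} ≤ C ‖u‖_∞ ‖v‖_{A_Φ}`. -/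
lemma IsNFunction.aPhiENorm_conv_le (h : IsNFunction Φ) (u v w : C₀(G, ℂ))
    (hv : v ∈ APhi Φ μ) (hw : ∀ x, w x = conv μ u v x) :
    aPhiENorm Φ μ w ≤ (luxemburgNorm Φ μ (fun _ : G => (1 : ℂ)) *
      orliczNorm (complementary Φ) μ (fun _ : G => (1 : ℂ))) * ‖u‖ₑ * aPhiENorm Φ μ v := by
  set C := luxemburgNorm Φ μ (fun _ : G => (1 : ℂ)) *
      orliczNorm (complementary Φ) μ (fun _ : G => (1 : ℂ)) with hC
  have hu : Continuous u := map_continuous u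
  have hCtop : C < ∞ := h.luxemburgNorm_one_mul_orliczNorm_one_lt_top
  have hCu : C * ‖u‖ₑ < ∞ := ENNReal.mul_lt_top hCtop enorm_lt_top
  have key : ∀ f g, Represents Φ μ v f g → aPhiENorm Φ μ w ≤ C * ‖u‖ₑ *
      ∑' n, luxemburgNorm Φ μ (f n) * orliczNorm (complementary Φ) μ (g n) := by
    intro f g hfg
    have hle : ∑' n, luxemburgNorm Φ μ (conv μ u (f n)) * orliczNorm (complementary Φ) μ (g n) ≤
        C * ‖u‖ₑ * ∑' n, luxemburgNorm Φ μ (f n) * orliczNorm (complementary Φ) μ (g n) := by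
      rw [← ENNReal.tsum_mul_left]
      refine ENNReal.tsum_le_tsum fun n => ?_
      rw [← mul_assoc]
      exact mul_le_mul_left (h.luxemburgNorm_conv_le u (hfg.mem_left n)) _
    have hrep : Represents Φ μ w (fun n => conv μ u (f n)) g :=
      { mem_left := fun n => h.conv_mem_morseTransue hu (hfg.mem_left n)
        mem_right := hfg.mem_right
        sum_lt_top := hle.trans_lt (ENNReal.mul_lt_top hCu hfg.sum_lt_top)
        hasSum := fun x => by
          rw [hw]
          simp only [h.conv_check_assoc hu (hfg.mem_left _) (hfg.mem_right _)]
          have hs : Summable fun n => ‖u‖ *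
              (luxemburgNorm Φ μ (f n) * orliczNorm (complementary Φ) μ (g n)).toReal :=
            (ENNReal.summable_toReal hfg.sum_lt_top.ne).mul_left _
          refine hasSum_integral_of_dominated_convergence (fun n _ => ‖u‖ *
              (luxemburgNorm Φ μ (f n) * orliczNorm (complementary Φ) μ (g n)).toReal)
            (fun n => hu.aestronglyMeasurable.mul
              (h.aestronglyMeasurable_conv_check (hfg.mem_left n) (hfg.mem_right n) x))
            (fun n => Eventually.of_forall fun y => ?_) (Eventually.of_forall fun y => hs)
            (integrable_const _) (Eventually.of_forall fun y => (hfg.hasSum _).mul_left _)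
          rw [norm_mul]
          exact mul_le_mul (norm_apply_le u y)
            (h.norm_conv_check_le (hfg.mem_left n) (hfg.mem_right n) _) (norm_nonneg _)
            (norm_nonneg _) }
    exact hrep.aPhiENorm_le.trans hle
  rcases eq_or_ne (C * ‖u‖ₑ) 0 with h0 | h0
  · obtain ⟨f, g, hfg⟩ := hv
    have := key f g hfg
    rw [h0, zero_mul] at this
    exact this.trans bot_le
  · conv_rhs => rw [aPhiENorm]
    simp only [ENNReal.mul_iInf_of_ne h0 hCu.ne]
    exact le_iInf fun f => le_iInf fun g => le_iInf fun hfg => key f g hfg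

omit [μ.IsMulRightInvariant] [μ.IsInvInvariant] in
/-- On a compact group the elements of `A_Φ(G)` are integrable continuous functions, so convolution is
defined everywhere, and the estimates `‖u * v‖_{A_Φ} ≤ C ‖u‖_∞ ‖v‖_{A_Φ}` and
`‖u‖_∞ ≤ ‖u‖_{A_Φ}` give the bound for products. -/
theorem IsNFunction.isConvBanachAlgebra_of_compactSpace (h : IsNFunction Φ) :
    IsConvBanachAlgebra μ (APhi Φ μ) (aPhiNorm Φ μ) := by
  have : μ.IsMulRightInvariant := isMulRightInvariant_of_compactSpace
  have : μ.IsInvInvariant := isInvInvariant_of_compactSpace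
  have hcont : ∀ u : C₀(G, ℂ), Continuous u := fun u => map_continuous u
  have hci : ∀ u v : C₀(G, ℂ), Continuous (conv μ u v) := fun u v =>
    continuous_conv_left (hcont u) (integrable_of_continuous (hcont v))
  have hint : ∀ (u v : C₀(G, ℂ)) (x : G), Integrable (fun y => u y * v (y⁻¹ * x)) μ := fun u v x =>
    integrable_of_continuous ((hcont u).mul ((hcont v).comp (by fun_prop)))
  have hfin : ∀ u ∈ APhi Φ μ, aPhiENorm Φ μ u ≠ ∞ := fun u hu => (mem_aPhi_iff.1 hu).ne
  set C := luxemburgNorm Φ μ (fun _ : G => (1 : ℂ)) *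
      orliczNorm (complementary Φ) μ (fun _ : G => (1 : ℂ)) with hC
  have hCtop : C < ∞ := h.luxemburgNorm_one_mul_orliczNorm_one_lt_top
  have hle : ∀ u v w : C₀(G, ℂ), v ∈ APhi Φ μ → (∀ x, w x = conv μ u v x) →
      aPhiENorm Φ μ w ≤ C * aPhiENorm Φ μ u * aPhiENorm Φ μ v := fun u v w hv hw =>
    (h.aPhiENorm_conv_le u v w hv hw).trans (by gcongr; exact h.enorm_le_aPhiENorm u)
  refine ⟨h.isBanachSubspace_aPhi, fun u _ v _ => Eventually.of_forall fun x => hint u v x,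
    fun u hu v hv => ?_, fun u _ v _ w _ => ?_, fun u _ v _ w _ => ?_, fun c u _ v _ => ?_,
    fun c u _ v _ => ?_, fun u _ v _ w _ => ?_, ?_⟩
  · refine ⟨ZeroAtInftyContinuousMap.ContinuousMap.liftZeroAtInfty ⟨conv μ u v, hci u v⟩, ?_,
      Eventually.of_forall fun x => rfl⟩
    refine mem_aPhi_iff.2 ((hle u v _ hv fun x => rfl).trans_lt ?_)
    exact ENNReal.mul_lt_top (ENNReal.mul_lt_top hCtop (hfin u hu).lt_top) (hfin v hv).lt_top
  · refine Eventually.of_forall fun x => ?_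
    simp only [conv, Pi.add_apply]
    rw [← integral_add (hint u w x) (hint v w x)]
    simp [add_mul]
  · refine Eventually.of_forall fun x => ?_
    simp only [conv, Pi.add_apply]
    rw [← integral_add (hint u v x) (hint u w x)]
    simp [mul_add]
  · refine Eventually.of_forall fun x => ?_
    simp only [conv, Pi.smul_apply, smul_eq_mul]
    rw [← integral_const_mul]
    simp [mul_assoc]
  · refine Eventually.of_forall fun x => ?_
    simp only [conv, Pi.smul_apply, smul_eq_mul]
    rw [← integral_const_mul]
    simp [mul_left_comm]
  · refine Eventually.of_forall fun x => ?_
    have hcc : check (check w) = w := by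
      funext y
      simp [check]
    have h1 := conv_check_eq (μ := μ) (conv μ u v) (check w) x
    rw [conv_check_assoc_of_continuous (g := check w) (hcont u) (hcont v)
      ((hcont w).comp continuous_inv) x] at h1
    rw [hcc] at h1
    exact h1
  -- `C.toReal` itself bounds the product; `1` is added because the constant has to be positive.
  · refine ⟨C.toReal + 1, by positivity, fun u hu v hv w _ hw => ?_⟩
    have hw' : ∀ x, w x = conv μ u v x :=
      congrFun ((Continuous.ae_eq_iff_eq μ (hcont w) (hci u v)).1 hw)
    have h1 := ENNReal.toReal_mono
      (ENNReal.mul_ne_top (ENNReal.mul_ne_top hCtop.ne (hfin u hu)) (hfin v hv)) (hle u v w hv hw')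
    rw [ENNReal.toReal_mul, ENNReal.toReal_mul] at h1
    refine h1.trans ?_
    change _ ≤ (C.toReal + 1) * (aPhiENorm Φ μ u).toReal * (aPhiENorm Φ μ v).toReal
    gcongr
    linarith

end Compact

/-! ### Almost invariant convex combinations of translates -/

section Amenable

variable {G : Type*} [MeasurableSpace G] [Group G] [TopologicalSpace G]
  [IsTopologicalGroup G] [BorelSpace G] {μ : Measure G} [μ.IsMulLeftInvariant]

lemma memLp_top_of_continuous {ψ : G → ℂ} (hψ : Continuous ψ) {M : ℝ} (hM : ∀ y, ‖ψ y‖ ≤ M) :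
    MemLp ψ ∞ μ :=
  memLp_top_of_bound hψ.aestronglyMeasurable M (Eventually.of_forall hM)

/-- A left invariant mean gives a sum of functions of the form `ψ(s ·) - ψ` the value `0`. -/
lemma mean_sum_translate_sub_eq_zero {ι : Type*} {m : Lp ℂ ∞ μ →L[ℂ] ℂ}
    (hm : ∀ (x : G) (φ : Lp ℂ ∞ μ),
      m (Lp.compMeasurePreserving (fun y => x⁻¹ * y) (measurePreserving_mul_left μ x⁻¹) φ) = m φ)
    {ψ : ι → G → ℂ} {s : ι → G} (hψ : ∀ i, MemLp (ψ i) ∞ μ) (T : Finset ι)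
    (h : MemLp (fun y => ∑ i ∈ T, (ψ i (s i * y) - ψ i y)) ∞ μ) : m (h.toLp _) = 0 := by
  classical
  induction T using Finset.induction_on with
  | empty =>
    have : h.toLp _ = 0 := by
      rw [← MemLp.toLp_zero (MemLp.zero : MemLp (0 : G → ℂ) ∞ μ)]
      exact MemLp.toLp_congr _ _ (Eventually.of_forall fun y => by simp)
    rw [this, map_zero]
  | insert i T hi ih =>
    have h1 : MemLp (fun y => ψ i (s i * y)) ∞ μ :=
      (hψ i).comp_measurePreserving (measurePreserving_mul_left μ (s i))
    have h2 : MemLp (fun y => ∑ j ∈ T, (ψ j (s j * y) - ψ j y)) ∞ μ :=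
      memLp_finsetSum _ fun j _ =>
        ((hψ j).comp_measurePreserving (measurePreserving_mul_left μ (s j))).sub (hψ j)
    have h3 : h.toLp _ = h1.toLp _ - (hψ i).toLp _ + h2.toLp _ := by
      rw [← MemLp.toLp_sub, ← MemLp.toLp_add]
      exact MemLp.toLp_congr _ _ (Eventually.of_forall fun y => by simp [Finset.sum_insert hi])
    have h4 : m (h1.toLp _) = m ((hψ i).toLp _) := by
      have := hm (s i)⁻¹ ((hψ i).toLp _)
      rw [Lp.toLp_compMeasurePreserving] at this
      rw [← this]
      exact congrArg m (MemLp.toLp_congr _ _ (Eventually.of_forall fun y => by simp))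
    rw [h3, map_add, map_sub, h4, ih h2]
    simp

/-- If `G` is amenable and `w : G → E` is bounded and continuous, then some convex combination of the
right translates of `w` is almost invariant under a given finite set. Otherwise the Hahn-Banach
theorem gives functionals `ψ_s` with `∑ (ψ_s(w(s y)) - ψ_s(w(y)))` bounded below by a positive
constant, and this contradicts the invariance of the mean. -/
theorem IsAmenable.exists_almost_invariant (hG : IsAmenable μ) {E : Type*} [NormedAddCommGroup E]
    [NormedSpace ℝ E] {w : G → E} (hw : Continuous w) {M : ℝ} (hM : ∀ y, ‖w y‖ ≤ M)
    (F : Finset G) {ε : ℝ} (hε : 0 < ε) :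
    ∃ (ι : Type) (_ : Fintype ι) (c : ι → ℝ) (y : ι → G), (∀ i, 0 ≤ c i) ∧ ∑ i, c i = 1 ∧
      ∀ s ∈ F, ‖∑ i, c i • (w (s * y i) - w (y i))‖ < ε := by
  classical
  set v : G → F → E := fun y s => w (s * y) - w y with hv
  by_cases h0 : (0 : F → E) ∈ closure (convexHull ℝ (Set.range v))
  · obtain ⟨b, hb, hdist⟩ := Metric.mem_closure_iff.1 h0 ε hε
    obtain ⟨ι, _, c, z, hc, hc1, hz, rfl⟩ := mem_convexHull_iff_exists_fintype.1 hb
    choose y hy using hz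
    refine ⟨ι, inferInstance, c, y, hc, hc1, fun s hs => ?_⟩
    rw [dist_zero_left] at hdist
    refine lt_of_le_of_lt ?_ hdist
    have := norm_le_pi_norm (∑ i, c i • z i) ⟨s, hs⟩
    refine le_of_eq_of_le ?_ this
    congr 1
    rw [Finset.sum_apply]
    refine Finset.sum_congr rfl fun i _ => ?_
    rw [← hy i]
    rfl
  · exfalso
    obtain ⟨f, u, hu0, hu⟩ := geometric_hahn_banach_point_closed
      (convex_convexHull ℝ (Set.range v)).closure isClosed_closure h0
    rw [map_zero] at hu0
    obtain ⟨m, hm1, hmone, hm⟩ := hG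
    have huv : ∀ y, u < f (v y) := fun y => hu _ (subset_closure (subset_convexHull ℝ _ ⟨y, rfl⟩))
    set R : ℝ := ‖f‖ * (2 * M) with hR
    have hvR : ∀ y, f (v y) ≤ R := fun y => by
      have hM0 : 0 ≤ M := (norm_nonneg _).trans (hM 1)
      refine (Real.le_norm_self _).trans ((f.le_opNorm _).trans ?_)
      refine mul_le_mul_of_nonneg_left ?_ (norm_nonneg _)
      refine (pi_norm_le_iff_of_nonneg (by positivity)).2 fun s => ?_
      refine (norm_sub_le _ _).trans ?_
      linarith [hM (s * y), hM y]
    let ψ : F → G → ℂ := fun s y => (f (Pi.single (M := fun _ : F => E) s (w y)) : ℝ)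
    have hψ : ∀ s, MemLp (ψ s) ∞ μ := fun s => by
      refine memLp_top_of_continuous (M := ‖f‖ * M) ?_ fun y => ?_
      · exact Complex.continuous_ofReal.comp
          (f.continuous.comp ((continuous_single s).comp hw))
      · rw [Complex.norm_real]
        refine (f.le_opNorm _).trans (mul_le_mul_of_nonneg_left ?_ (norm_nonneg _))
        rw [Pi.norm_single]
        exact hM y
    have hfv : ∀ y, ((f (v y) : ℝ) : ℂ) = ∑ s : F, (ψ s (s * y) - ψ s y) := fun y => by
      have h1 : v y = ∑ s : F, (Pi.single s (w (s * y)) - Pi.single (M := fun _ : F => E) s (w y)) := by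
        simp only [← Pi.single_sub]
        exact (Finset.univ_sum_single (v y)).symm
      rw [h1, map_sum]
      push_cast
      exact Finset.sum_congr rfl fun s _ => by simp [ψ]
    have hsum : MemLp (fun y => ∑ s : F, (ψ s (s * y) - ψ s y)) ∞ μ :=
      memLp_finsetSum _ fun s _ =>
        ((hψ s).comp_measurePreserving (measurePreserving_mul_left μ (s : G))).sub (hψ s)
    have hzero := mean_sum_translate_sub_eq_zero hm (s := fun s : F => (s : G)) hψ Finset.univ hsum
    have hone : MemLp (fun _ : G => (1 : ℂ)) ∞ μ := memLp_top_const 1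
    -- `m` takes the value `R` at `R - f ∘ v`, but this function has norm at most `R - u < R`.
    have hval : m ((R : ℂ) • hone.toLp _ - hsum.toLp _) = R := by
      rw [map_sub, hzero, map_smul, hmone]
      simp
    have hnorm : ‖(R : ℂ) • hone.toLp _ - hsum.toLp _‖ ≤ R - u := by
      rw [← MemLp.toLp_const_smul, ← MemLp.toLp_sub, Lp.norm_toLp]
      refine ENNReal.toReal_le_of_le_ofReal (by linarith [huv 1, hvR 1]) ?_
      rw [eLpNorm_exponent_top]
      refine eLpNormEssSup_le_of_ae_bound (Eventually.of_forall fun y => ?_)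
      have h2 : ((R : ℂ) • (fun _ : G => (1 : ℂ)) - fun y => ∑ s : F, (ψ s (s * y) - ψ s y)) y =
          ((R - f (v y) : ℝ) : ℂ) := by
        simp [hfv]
      rw [h2, Complex.norm_real, Real.norm_of_nonneg (by linarith [hvR y])]
      linarith [huv y]
    have h3 := (m.le_opNorm ((R : ℂ) • hone.toLp _ - hsum.toLp _)).trans
      (mul_le_mul_of_nonneg_left hnorm (norm_nonneg _))
    rw [hval, hm1, Complex.norm_real, one_mul] at h3
    linarith [Real.le_norm_self R]

end Amenable

/-! ### Integrals of compactly supported functions and the modular character -/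

section Modular

open Measure
open scoped Pointwise

variable {G : Type*} [MeasurableSpace G] [Group G] [TopologicalSpace G]
  [IsTopologicalGroup G] [BorelSpace G] [LocallyCompactSpace G] [T2Space G]
  {μ : Measure G} [μ.IsHaarMeasure] [μ.Regular]

lemma continuous_integral_of_locally_compact_support {X : Type*} [TopologicalSpace X]
    {P : X → G → ℝ} (hP : Continuous P.uncurry)
    (hs : ∀ x₀, ∃ U ∈ 𝓝 x₀, ∃ K, IsCompact K ∧ ∀ x ∈ U, ∀ z ∉ K, P x z = 0) :
    Continuous fun x => ∫ z, P x z ∂μ := by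
  refine continuous_iff_continuousAt.2 fun x₀ => ?_
  obtain ⟨U, hU, K, hK, h⟩ := hs x₀
  exact (continuousOn_integral_of_compact_support hK hP.continuousOn
    (fun p x hp hx => h p hp x hx)).continuousAt hU

lemma continuous_integral_left {k : G → G → ℝ} (hk : Continuous k.uncurry)
    (hs : HasCompactSupport k.uncurry) : Continuous fun z => ∫ s, k s z ∂μ := by
  refine continuous_integral_of_locally_compact_support (P := fun z s => k s z)
    (hk.comp continuous_swap) fun z₀ => ⟨Set.univ, univ_mem, _, hs.image continuous_fst, ?_⟩
  intro z _ s hs'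
  by_contra h
  exact hs' ⟨(s, z), subset_tsupport _ h, rfl⟩

lemma hasCompactSupport_integral_left {k : G → G → ℝ} (hs : HasCompactSupport k.uncurry) :
    HasCompactSupport fun z => ∫ s, k s z ∂μ := by
  refine HasCompactSupport.intro (hs.image continuous_snd) fun z hz => ?_
  have : ∀ s, k s z = 0 := fun s => by
    by_contra h
    exact hz ⟨(s, z), subset_tsupport _ h, rfl⟩
  simp [this]

lemma integral_abs_integral_le {k : G → G → ℝ} (hk : Continuous k.uncurry)
    (hs : HasCompactSupport k.uncurry) :
    ∫ z, |∫ s, k s z ∂μ| ∂μ ≤ ∫ s, ∫ z, |k s z| ∂μ ∂μ := by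
  have hk' : Continuous (Function.uncurry fun s z => |k s z|) := hk.abs
  have hs' : HasCompactSupport (Function.uncurry fun s z => |k s z|) :=
    hs.comp_left (g := fun t : ℝ => |t|) abs_zero
  rw [integral_integral_swap_of_hasCompactSupport hk' hs']
  refine integral_mono_of_nonneg (Eventually.of_forall fun z => abs_nonneg _)
    ((continuous_integral_left hk' hs').integrable_of_hasCompactSupport
      (hasCompactSupport_integral_left hs')) (Eventually.of_forall fun z => ?_)
  exact norm_integral_le_integral_norm fun s => k s z

lemma integral_comp_mul_right_eq {f : G → ℝ} (hf : Continuous f) (hs : HasCompactSupport f) (g : G) :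
    ∫ z, f (z * g) ∂μ = modularCharacterFun g * ∫ z, f z ∂μ := by
  have h := integral_isMulLeftInvariant_eq_smul_of_hasCompactSupport (map (· * g) μ) μ hf hs
  rw [← modularCharacterFun_eq_haarScalarFactor, integral_smul_nnreal_measure,
    integral_map (measurable_mul_const g).aemeasurable hf.aestronglyMeasurable] at h
  exact h

lemma modularCharacterFun_coe_pos (g : G) : (0 : ℝ) < modularCharacterFun g :=
  NNReal.coe_pos.2 (modularCharacterFun_pos g)

lemma modularCharacterFun_mul_inv (g : G) :
    (modularCharacterFun g : ℝ) * modularCharacterFun g⁻¹ = 1 := by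
  rw [← NNReal.coe_mul, ← modularCharacterFun_map_mul, mul_inv_cancel, modularCharacterFun_map_one,
    NNReal.coe_one]

/-- Right translation, normalized by the modular character, preserves integrals. -/
lemma integral_modularCharacterFun_mul_comp {f : G → ℝ} (hf : Continuous f)
    (hs : HasCompactSupport f) (y : G) :
    ∫ z, modularCharacterFun y * f (z * y⁻¹) ∂μ = ∫ z, f z ∂μ := by
  rw [integral_const_mul, integral_comp_mul_right_eq hf hs, ← mul_assoc,
    modularCharacterFun_mul_inv, one_mul]

/-- A nonnegative continuous function of integral one that vanishes outside a given neighbourhood of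
the identity. -/
lemma exists_bump {W : Set G} (hW : IsOpen W) (h1 : (1 : G) ∈ W) :
    ∃ f : G → ℝ, Continuous f ∧ HasCompactSupport f ∧ (∀ x, 0 ≤ f x) ∧ ∫ x, f x ∂μ = 1 ∧
      ∀ x ∉ W, f x = 0 := by
  obtain ⟨f, hf1, hf0, hfs, hf⟩ := exists_continuous_one_zero_of_isCompact
    (isCompact_singleton (x := (1 : G))) hW.isClosed_compl (by simpa using h1)
  have hpos : 0 < ∫ x, f x ∂μ :=
    f.continuous.integral_pos_of_hasCompactSupport_nonneg_nonzero hfs (fun x => (hf x).1)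
      (x := 1) (by rw [hf1 rfl]; simp)
  refine ⟨fun x => (∫ x, f x ∂μ)⁻¹ * f x, by fun_prop, hfs.mul_left,
    fun x => mul_nonneg (inv_nonneg.2 hpos.le) (hf x).1, ?_, fun x hx => ?_⟩
  · rw [integral_const_mul, inv_mul_cancel₀ hpos.ne']
  · simp [show f x = 0 from hf0 hx]

lemma continuous_modularCharacterFun : Continuous fun g : G => (modularCharacterFun g : ℝ) := by
  obtain ⟨f, hf, hs, -, hf1, -⟩ := exists_bump (μ := (haar : Measure G)) isOpen_univ
    (Set.mem_univ (1 : G))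
  have h : (fun g : G => (modularCharacterFun g : ℝ)) = fun g => ∫ z, f (z * g) ∂haar :=
    funext fun g => by rw [integral_comp_mul_right_eq hf hs, hf1, mul_one]
  rw [h]
  refine continuous_integral_of_locally_compact_support (P := fun g z => f (z * g))
    (hf.comp (continuous_snd.mul continuous_fst)) fun g₀ => ?_
  obtain ⟨U, hU, hU'⟩ := exists_compact_mem_nhds g₀
  refine ⟨U, hU', _, hs.isCompact.mul hU.inv, fun g hg z hz => image_eq_zero_of_notMem_tsupport ?_⟩
  exact fun h => hz ⟨z * g, h, g⁻¹, Set.inv_mem_inv.2 hg, by simp⟩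

/-- Left translation is continuous in `L¹`, uniformly on compact sets. -/
lemma exists_isOpen_integral_translate_sub_lt {l : G → ℝ} (hl : Continuous l)
    (hs : HasCompactSupport l) {K : Set G} (hK : IsCompact K) {ε : ℝ} (hε : 0 < ε) :
    ∃ W : Set G, IsOpen W ∧ 1 ∈ W ∧
      ∀ s ∈ W, ∀ x ∈ K, ∫ z, |l (x⁻¹ * (s * z)) - l (x⁻¹ * z)| ∂μ < ε := by
  have hq : Continuous fun p : G × G => ∫ z, |l (p.1 * z) - l (p.2 * z)| ∂μ := by
    refine continuous_integral_of_locally_compact_support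
      (P := fun (p : G × G) z => |l (p.1 * z) - l (p.2 * z)|) ?_ fun p₀ => ?_
    · simp only [Function.uncurry_def]
      fun_prop
    · obtain ⟨U, hU, hU'⟩ := exists_compact_mem_nhds p₀.1
      obtain ⟨V, hV, hV'⟩ := exists_compact_mem_nhds p₀.2
      refine ⟨U ×ˢ V, prod_mem_nhds hU' hV', _, (hU.inv.mul hs.isCompact).union
        (hV.inv.mul hs.isCompact), fun p hp z hz => ?_⟩
      rw [image_eq_zero_of_notMem_tsupport fun h =>
          hz (Or.inl ⟨p.1⁻¹, Set.inv_mem_inv.2 hp.1, p.1 * z, h, by simp⟩),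
        image_eq_zero_of_notMem_tsupport fun h =>
          hz (Or.inr ⟨p.2⁻¹, Set.inv_mem_inv.2 hp.2, p.2 * z, h, by simp⟩)]
      simp
  have hev : ∀ᶠ s in 𝓝 (1 : G), ∀ x ∈ K, ∫ z, |l (x⁻¹ * s * z) - l (x⁻¹ * z)| ∂μ < ε := by
    refine hK.eventually_forall_of_forall_eventually fun x _ => ?_
    have hc : Continuous fun p : G × G => ∫ z, |l (p.2⁻¹ * p.1 * z) - l (p.2⁻¹ * z)| ∂μ :=
      hq.comp (f := fun p : G × G => (p.2⁻¹ * p.1, p.2⁻¹)) (by fun_prop)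
    refine hc.continuousAt.eventually_lt_const ?_
    simpa using hε
  obtain ⟨W, hW, hWo, h1⟩ := mem_nhds_iff.1 hev
  exact ⟨W, hWo, h1, fun s hs x hx => by simpa [mul_assoc] using hW hs x hx⟩

/-- The function `z ↦ Δ(z) κ(s z⁻¹)`. With `e(z) = Δ(z) κ(z⁻¹)` it is the density of `e * δ_s`. -/
def translateKernel (κ : G → ℝ) (s z : G) : ℝ := modularCharacterFun z * κ (s * z⁻¹)

section Kernel

variable {κ : G → ℝ} (hκ : Continuous κ) (hs : HasCompactSupport κ)

include hκ in
lemma continuous_translateKernel : Continuous (translateKernel κ).uncurry := by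
  have := continuous_modularCharacterFun (G := G)
  simp only [Function.uncurry_def, translateKernel]
  exact (this.comp continuous_snd).mul (hκ.comp (by fun_prop))

lemma translateKernel_eq_zero {s z : G} (h : z ∉ (tsupport κ)⁻¹ * {s}) :
    translateKernel κ s z = 0 := by
  rw [translateKernel, image_eq_zero_of_notMem_tsupport (f := κ), mul_zero]
  intro h'
  exact h ⟨(s * z⁻¹)⁻¹, Set.inv_mem_inv.2 h', s, rfl, by simp⟩

include hs in
lemma hasCompactSupport_translateKernel (s : G) : HasCompactSupport (translateKernel κ s) :=
  HasCompactSupport.intro (hs.isCompact.inv.mul isCompact_singleton)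
    fun _ hz => translateKernel_eq_zero hz

lemma translateKernel_mul (s y z : G) :
    translateKernel κ (s * y) z = modularCharacterFun y * translateKernel κ s (z * y⁻¹) := by
  have h : (modularCharacterFun z : ℝ) = modularCharacterFun y * modularCharacterFun (z * y⁻¹) := by
    rw [← NNReal.coe_mul, mul_comm, ← modularCharacterFun_map_mul, inv_mul_cancel_right]
  simp only [translateKernel]
  rw [h]
  simp [mul_assoc]

include hκ hs in
lemma integral_abs_translateKernel_mul_sub (s t y : G) :
    ∫ z, |translateKernel κ (s * y) z - translateKernel κ (t * y) z| ∂μ =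
      ∫ z, |translateKernel κ s z - translateKernel κ t z| ∂μ := by
  have hc := continuous_translateKernel hκ
  have h1 : ∀ s, Continuous (translateKernel κ s) := fun s => hc.comp (Continuous.prodMk_right s)
  rw [← integral_modularCharacterFun_mul_comp (f := fun z =>
    |translateKernel κ s z - translateKernel κ t z|) ((h1 s).sub (h1 t)).abs
    (((hasCompactSupport_translateKernel hs s).sub
      (hasCompactSupport_translateKernel hs t)).comp_left (g := fun r : ℝ => |r|) abs_zero) y]
  refine integral_congr_ae (Eventually.of_forall fun z => ?_)
  simp only [translateKernel_mul, ← mul_sub, abs_mul, abs_of_pos (modularCharacterFun_coe_pos y)]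

include hκ hs in
lemma continuous_integral_abs_translateKernel_sub (t : G) :
    Continuous fun s => ∫ z, |translateKernel κ s z - translateKernel κ t z| ∂μ := by
  have hc := continuous_translateKernel hκ
  have h1 : Continuous (translateKernel κ t) := hc.comp (Continuous.prodMk_right t)
  refine continuous_integral_of_locally_compact_support
    (P := fun s z => |translateKernel κ s z - translateKernel κ t z|)
    (hc.sub (h1.comp continuous_snd)).abs fun s₀ => ?_
  obtain ⟨U, hU, hU'⟩ := exists_compact_mem_nhds s₀
  refine ⟨U, hU', _, (hs.isCompact.inv.mul hU).union
    (hs.isCompact.inv.mul (isCompact_singleton (x := t))), fun s hs' z hz => ?_⟩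
  rw [translateKernel_eq_zero fun h => hz (Or.inl (Set.mul_subset_mul_left (by simpa using hs') h)),
    translateKernel_eq_zero fun h => hz (Or.inr h)]
  simp

include hκ hs in
lemma integral_mul_translateKernel {f : G → ℝ} (hf : Continuous f) (y z : G) :
    ∫ s, f s * translateKernel κ (s * y) z ∂μ =
      modularCharacterFun y * ∫ s, κ s * f (s * (z * y⁻¹)) ∂μ := by
  have hc : Continuous fun s => κ s * f (s * (z * y⁻¹)) := by fun_prop
  have h := integral_comp_mul_right_eq (μ := μ) hc hs.mul_right (z * y⁻¹)⁻¹
  have h2 : (modularCharacterFun z : ℝ) * modularCharacterFun (z * y⁻¹)⁻¹ = modularCharacterFun y := by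
    rw [← NNReal.coe_mul, mul_comm, ← modularCharacterFun_map_mul]
    simp
  rw [← h2, mul_assoc, ← h, ← integral_const_mul]
  refine integral_congr_ae (Eventually.of_forall fun s => ?_)
  have e1 : s * (z * y⁻¹)⁻¹ * (z * y⁻¹) = s := inv_mul_cancel_right _ _
  have e2 : s * (z * y⁻¹)⁻¹ = s * y * z⁻¹ := by simp [mul_assoc]
  simp only [translateKernel]
  rw [e1, e2]
  ring

/-- The class of `translateKernel κ s` in `L¹`. -/
def translateKernelL1 (μ : Measure G) [μ.IsHaarMeasure] [μ.Regular] (s : G) : Lp ℝ 1 μ :=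
  (((continuous_translateKernel hκ).comp
    (Continuous.prodMk_right s)).integrable_of_hasCompactSupport
      (hasCompactSupport_translateKernel hs s) : Integrable (translateKernel κ s) μ).toL1 _

lemma norm_sum_translateKernelL1 {ι : Type*} [Fintype ι] (c : ι → ℝ) (s t : ι → G) :
    ‖∑ i, c i • (translateKernelL1 hκ hs μ (s i) - translateKernelL1 hκ hs μ (t i))‖ =
      ∫ z, |∑ i, c i * (translateKernel κ (s i) z - translateKernel κ (t i) z)| ∂μ := by
  rw [L1.norm_eq_integral_norm]
  refine integral_congr_ae ?_
  have h1 : ∀ s, translateKernelL1 hκ hs μ s =ᵐ[μ] translateKernel κ s := fun s =>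
    Integrable.coeFn_toL1 _
  have h2 : ∀ᵐ z ∂μ, ∀ i, (c i • (translateKernelL1 hκ hs μ (s i) -
      translateKernelL1 hκ hs μ (t i)) : Lp ℝ 1 μ) z =
      c i * (translateKernel κ (s i) z - translateKernel κ (t i) z) := by
    refine ae_all_iff.2 fun i => ?_
    filter_upwards [h1 (s i), h1 (t i), Lp.coeFn_smul (c i)
      (translateKernelL1 hκ hs μ (s i) - translateKernelL1 hκ hs μ (t i)),
      Lp.coeFn_sub (translateKernelL1 hκ hs μ (s i)) (translateKernelL1 hκ hs μ (t i))]
      with z e1 e2 e3 e4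
    rw [e3, Pi.smul_apply, e4, Pi.sub_apply, e1, e2, smul_eq_mul]
  filter_upwards [h2, Lp.coeFn_finsetSum Finset.univ fun i => c i •
    (translateKernelL1 hκ hs μ (s i) - translateKernelL1 hκ hs μ (t i))] with z e1 e2
  rw [e2, Finset.sum_apply, Real.norm_eq_abs]
  simp only [e1]

lemma norm_translateKernelL1_sub (s t : G) :
    ‖translateKernelL1 hκ hs μ s - translateKernelL1 hκ hs μ t‖ =
      ∫ z, |translateKernel κ s z - translateKernel κ t z| ∂μ := by
  have := norm_sum_translateKernelL1 (μ := μ) hκ hs (fun _ : Unit => 1) (fun _ => s) (fun _ => t)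
  simpa using this

lemma continuous_translateKernelL1 : Continuous (translateKernelL1 hκ hs μ) := by
  refine continuous_iff_continuousAt.2 fun t => ?_
  rw [ContinuousAt, tendsto_iff_norm_sub_tendsto_zero]
  simp only [norm_translateKernelL1_sub]
  have := (continuous_integral_abs_translateKernel_sub (μ := μ) hκ hs t).tendsto t
  simpa using this

lemma norm_translateKernelL1 (y : G) :
    ‖translateKernelL1 hκ hs μ y‖ = ‖translateKernelL1 hκ hs μ 1‖ := by
  have h1 : ∀ s, ‖translateKernelL1 hκ hs μ s‖ = ∫ z, |translateKernel κ s z| ∂μ := fun s =>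
    L1.norm_of_fun_eq_integral_norm _
  have hc : Continuous (translateKernel κ 1) :=
    (continuous_translateKernel hκ).comp (Continuous.prodMk_right 1)
  rw [h1, h1, ← integral_modularCharacterFun_mul_comp (f := fun z => |translateKernel κ 1 z|) hc.abs
    ((hasCompactSupport_translateKernel hs 1).comp_left (g := fun r : ℝ => |r|) abs_zero) y]
  refine integral_congr_ae (Eventually.of_forall fun z => ?_)
  have := translateKernel_mul (κ := κ) 1 y z
  rw [one_mul] at this
  simp only [this, abs_mul, abs_of_pos (modularCharacterFun_coe_pos y)]

end Kernel

end Modular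

/-! ### Reiter's condition -/

section Reiter

open Measure
open scoped Pointwise

variable {G : Type*} [MeasurableSpace G] [Group G] [TopologicalSpace G]
  [IsTopologicalGroup G] [BorelSpace G] [LocallyCompactSpace G] [T2Space G]
  {μ : Measure G} [μ.IsHaarMeasure] [μ.Regular]

/-- Averages over right translates: if the convex combination `∑ cᵢ δ_{yᵢ}` is almost invariant under
all `s ∈ L` after smoothing by `κ`, and `f` is a density that vanishes outside `L` and is hardly
moved by the support of `κ`, then the smoothed combination is close to the translated combination of
`f`. -/
lemma integral_abs_sum_translateKernel_sub_le {κ f : G → ℝ} (hκ : Continuous κ)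
    (hκs : HasCompactSupport κ) (hκ0 : ∀ x, 0 ≤ κ x) (hκ1 : ∫ x, κ x ∂μ = 1) (hf : Continuous f)
    (hfs : HasCompactSupport f) (hf0 : ∀ x, 0 ≤ f x) (hf1 : ∫ x, f x ∂μ = 1)
    {ι : Type*} [Fintype ι] {c : ι → ℝ} {y : ι → G} (hc0 : ∀ i, 0 ≤ c i) (hc1 : ∑ i, c i = 1)
    {L W : Set G} (hL : ∀ s ∉ L, f s = 0) (hW : ∀ s ∉ W, κ s = 0) {ε₁ ε₂ : ℝ}
    (h1 : ∀ s ∈ L, ∫ z, |∑ i, c i * (translateKernel κ (s * y i) z - translateKernel κ (y i) z)| ∂μ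
      ≤ ε₁)
    (h2 : ∀ s ∈ W, ∫ z, |f (s * z) - f z| ∂μ ≤ ε₂) :
    ∫ z, |∑ i, c i * translateKernel κ (y i) z -
      ∑ i, c i * (modularCharacterFun (y i) * f (z * (y i)⁻¹))| ∂μ ≤ ε₁ + ε₂ := by
  have hP := continuous_translateKernel hκ
  have hPz : ∀ s, Continuous (translateKernel κ s) := fun s => hP.comp (Continuous.prodMk_right s)
  have hPs : ∀ (g : G) z, Continuous fun s => translateKernel κ (s * g) z := fun g z =>
    hP.comp (f := fun s => (s * g, z)) (by fun_prop)
  -- The difference splits as `A z + ∑ cᵢ Δ(yᵢ) E(z yᵢ⁻¹)`, where `A` and `E` are the integrals over `s`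
  -- of the kernels `k₁` and `k₂`, which the two hypotheses bound in `L¹`.
  set k₁ : G → G → ℝ := fun s z =>
    f s * ∑ i, c i * (translateKernel κ (y i) z - translateKernel κ (s * y i) z) with hk₁
  set k₂ : G → G → ℝ := fun s z => κ s * (f (s * z) - f z) with hk₂
  have hk₁c : Continuous k₁.uncurry := by
    refine (hf.comp continuous_fst).mul (continuous_finsetSum _ fun i _ => continuous_const.mul ?_)
    exact ((hPz (y i)).comp continuous_snd).sub
      (hP.comp (f := fun p : G × G => (p.1 * y i, p.2)) (by fun_prop))
  have hk₂c : Continuous k₂.uncurry := by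
    simp only [hk₂, Function.uncurry_def]
    fun_prop
  have hk₁s : HasCompactSupport k₁.uncurry := by
    have hY : IsCompact (Set.range y) := (Set.finite_range y).isCompact
    refine HasCompactSupport.intro (hfs.isCompact.prod ((hκs.isCompact.inv.mul hY).union
      (hκs.isCompact.inv.mul (hfs.isCompact.mul hY)))) ?_
    rintro ⟨s, z⟩ hsz
    by_cases hs : s ∈ tsupport f
    · have hz := fun h => hsz ⟨hs, h⟩
      refine mul_eq_zero_of_right _ (Finset.sum_eq_zero fun i _ => ?_)
      rw [translateKernel_eq_zero fun h => hz (Or.inl (Set.mul_subset_mul_left (by simp) h)),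
        translateKernel_eq_zero fun h => hz (Or.inr (Set.mul_subset_mul_left
          (Set.singleton_subset_iff.2 (Set.mul_mem_mul hs (Set.mem_range_self i))) h))]
      simp
    · exact mul_eq_zero_of_left (image_eq_zero_of_notMem_tsupport hs) _
  have hk₂s : HasCompactSupport k₂.uncurry := by
    refine HasCompactSupport.intro (hκs.isCompact.prod (hfs.isCompact.union
      (hκs.isCompact.inv.mul hfs.isCompact))) ?_
    rintro ⟨s, z⟩ hsz
    by_cases hs : s ∈ tsupport κ
    · have hz := fun h => hsz ⟨hs, h⟩
      refine mul_eq_zero_of_right _ ?_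
      rw [image_eq_zero_of_notMem_tsupport fun h => hz (Or.inl h),
        image_eq_zero_of_notMem_tsupport fun h =>
          hz (Or.inr ⟨s⁻¹, Set.inv_mem_inv.2 hs, s * z, h, by simp⟩)]
      simp
    · exact mul_eq_zero_of_left (image_eq_zero_of_notMem_tsupport hs) _
  set A : G → ℝ := fun z => ∫ s, k₁ s z ∂μ with hA
  set E : G → ℝ := fun z => ∫ s, k₂ s z ∂μ with hE
  have hAc : Continuous A := continuous_integral_left hk₁c hk₁s
  have hEc : Continuous E := continuous_integral_left hk₂c hk₂s
  have hAs : HasCompactSupport A := hasCompactSupport_integral_left hk₁s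
  have hEs : HasCompactSupport E := hasCompactSupport_integral_left hk₂s
  have hfi : Integrable f μ := hf.integrable_of_hasCompactSupport hfs
  have hκi : Integrable κ μ := hκ.integrable_of_hasCompactSupport hκs
  have hsplit : ∀ z, ∑ i, c i * translateKernel κ (y i) z -
      ∑ i, c i * (modularCharacterFun (y i) * f (z * (y i)⁻¹)) =
      A z + ∑ i, c i * (modularCharacterFun (y i) * E (z * (y i)⁻¹)) := by
    intro z
    have hAz : A z = ∑ i, c i * (translateKernel κ (y i) z -
        ∫ s, f s * translateKernel κ (s * y i) z ∂μ) := by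
      have hi : ∀ i, Integrable (fun s => f s * translateKernel κ (s * y i) z) μ := fun i =>
        (hf.mul (hPs _ _)).integrable_of_hasCompactSupport hfs.mul_right
      have : ∀ s, k₁ s z = ∑ i, (c i * translateKernel κ (y i) z * f s -
          c i * (f s * translateKernel κ (s * y i) z)) := fun s => by
        simp only [hk₁, Finset.mul_sum]
        exact Finset.sum_congr rfl fun i _ => by ring
      simp only [hA, this]
      rw [integral_finsetSum]
      swap
      · exact fun i _ => (hfi.const_mul _).sub ((hi i).const_mul _)
      refine Finset.sum_congr rfl fun i _ => ?_
      rw [integral_sub (hfi.const_mul _) ((hi i).const_mul _), integral_const_mul,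
        integral_const_mul, hf1]
      ring
    have hEz : ∀ z, E z = ∫ s, κ s * f (s * z) ∂μ - f z := fun z => by
      have hi : Integrable (fun s => κ s * f (s * z)) μ :=
        (hκ.mul (hf.comp (by fun_prop))).integrable_of_hasCompactSupport hκs.mul_right
      simp only [hE, hk₂, mul_sub]
      rw [integral_sub hi (hκi.mul_const _), integral_mul_const, hκ1, one_mul]
    rw [hAz, ← Finset.sum_sub_distrib, ← Finset.sum_add_distrib]
    refine Finset.sum_congr rfl fun i _ => ?_
    rw [integral_mul_translateKernel hκ hκs hf, hEz]
    ring
  have hA1 : ∫ z, |A z| ∂μ ≤ ε₁ := by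
    refine (integral_abs_integral_le hk₁c hk₁s).trans ?_
    have h3 : ∀ s, ∫ z, |k₁ s z| ∂μ ≤ ε₁ * f s := fun s => by
      by_cases hs : s ∈ L
      · simp only [hk₁, abs_mul, abs_of_nonneg (hf0 s)]
        rw [integral_const_mul, mul_comm]
        refine mul_le_mul_of_nonneg_right (le_of_eq_of_le ?_ (h1 s hs)) (hf0 s)
        refine integral_congr_ae (Eventually.of_forall fun z => ?_)
        simp only
        rw [← abs_neg, ← Finset.sum_neg_distrib]
        exact congrArg _ (Finset.sum_congr rfl fun i _ => by ring)
      · simp [hk₁, hL s hs]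
    refine (integral_mono_of_nonneg (Eventually.of_forall fun s => integral_nonneg fun z =>
      abs_nonneg _) (hfi.const_mul ε₁) (Eventually.of_forall h3)).trans ?_
    rw [integral_const_mul, hf1, mul_one]
  have hE1 : ∫ z, |E z| ∂μ ≤ ε₂ := by
    refine (integral_abs_integral_le hk₂c hk₂s).trans ?_
    have h3 : ∀ s, ∫ z, |k₂ s z| ∂μ ≤ ε₂ * κ s := fun s => by
      by_cases hs : s ∈ W
      · simp only [hk₂, abs_mul, abs_of_nonneg (hκ0 s)]
        rw [integral_const_mul, mul_comm]
        exact mul_le_mul_of_nonneg_right (h2 s hs) (hκ0 s)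
      · simp [hk₂, hW s hs]
    refine (integral_mono_of_nonneg (Eventually.of_forall fun s => integral_nonneg fun z =>
      abs_nonneg _) (hκi.const_mul ε₂) (Eventually.of_forall h3)).trans ?_
    rw [integral_const_mul, hκ1, mul_one]
  have hEa : Continuous fun z => |E z| := hEc.abs
  have hEas : HasCompactSupport fun z => |E z| := hEs.comp_left (g := fun r : ℝ => |r|) abs_zero
  have hEi : ∀ i, Integrable (fun z => c i * (modularCharacterFun (y i) * |E (z * (y i)⁻¹)|)) μ :=
    fun i => by
      refine Integrable.const_mul (Integrable.const_mul ?_ _) _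
      exact (hEa.comp (continuous_mul_const _)).integrable_of_hasCompactSupport
        (hEas.comp_homeomorph (Homeomorph.mulRight (y i)⁻¹))
  have hAi : Integrable (fun z => |A z|) μ := (hAc.integrable_of_hasCompactSupport hAs).abs
  have hbound : ∀ z, |∑ i, c i * translateKernel κ (y i) z -
      ∑ i, c i * (modularCharacterFun (y i) * f (z * (y i)⁻¹))| ≤
      |A z| + ∑ i, c i * (modularCharacterFun (y i) * |E (z * (y i)⁻¹)|) := fun z => by
    rw [hsplit]
    refine (abs_add_le _ _).trans (add_le_add le_rfl ((Finset.abs_sum_le_sum_abs _ _).trans ?_))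
    refine Finset.sum_le_sum fun i _ => le_of_eq ?_
    rw [abs_mul, abs_mul, abs_of_nonneg (hc0 i), abs_of_pos (modularCharacterFun_coe_pos _)]
  refine (integral_mono_of_nonneg (Eventually.of_forall fun z => abs_nonneg _)
    (hAi.add (integrable_finsetSum _ fun i _ => hEi i)) (Eventually.of_forall hbound)).trans ?_
  rw [integral_add' hAi (integrable_finsetSum _ fun i _ => hEi i),
    integral_finsetSum _ fun i _ => hEi i]
  refine add_le_add hA1 (le_trans (le_of_eq ?_) hE1)
  simp only [integral_const_mul]
  rw [← one_mul (∫ z, |E z| ∂μ), ← hc1, Finset.sum_mul]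
  refine Finset.sum_congr rfl fun i _ => ?_
  rw [← integral_const_mul, integral_modularCharacterFun_mul_comp hEa hEas]

/-- A form of Reiter's condition for amenable groups: there are densities `a` and `b` such that all
translates of `b` by elements of a given compact set are close to `a` in `L¹`. Here
`a = ∑ cᵢ e * δ_{yᵢ}` and `b = ∑ cᵢ l * δ_{yᵢ}` for a fixed density `l`, a density `e` concentrated near
the identity, and a convex combination `∑ cᵢ δ_{yᵢ}` that is almost invariant under a finite set of
translations. This finite set is fine enough to control all translations by the compact set
`K · supp l`, because `s ↦ e * δ_s` is continuous in `L¹`. -/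
theorem IsAmenable.exists_almost_invariant_density (hG : IsAmenable μ) {K : Set G}
    (hK : IsCompact K) :
    ∃ a b : G → ℝ, Continuous a ∧ HasCompactSupport a ∧ (∀ z, 0 ≤ a z) ∧ Continuous b ∧
      HasCompactSupport b ∧ (∀ z, 0 ≤ b z) ∧ ∫ z, b z ∂μ = 1 ∧
      ∀ x ∈ K, ∫ z, |a z - b (x⁻¹ * z)| ∂μ ≤ 1 / 2 := by
  obtain ⟨l, hl, hls, hl0, hl1, -⟩ := exists_bump (μ := μ) isOpen_univ (Set.mem_univ (1 : G))
  obtain ⟨W, hWo, h1W, hW⟩ := exists_isOpen_integral_translate_sub_lt (μ := μ) hl hls hK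
    (ε := 1 / 6) (by norm_num)
  obtain ⟨κ, hκ, hκs, hκ0, hκ1, hκW⟩ := exists_bump (μ := μ) hWo h1W
  set w := translateKernelL1 hκ hκs μ with hw
  have hwc : Continuous w := continuous_translateKernelL1 hκ hκs
  obtain ⟨F, -, hcov⟩ := (hK.mul hls.isCompact).elim_nhds_subcover
    (fun t => {s | ‖w s - w t‖ < 1 / 6}) fun t _ => by
      have : Continuous fun s => ‖w s - w t‖ := (hwc.sub continuous_const).norm
      exact this.continuousAt.eventually_lt_const (by simp)
  obtain ⟨ι, _, c, y, hc0, hc1, hcF⟩ := hG.exists_almost_invariant hwc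
    (fun y => (norm_translateKernelL1 hκ hκs y).le) F (ε := 1 / 6) (by norm_num)
  have hD : ∀ s ∈ K * tsupport l,
      ∫ z, |∑ i, c i * (translateKernel κ (s * y i) z - translateKernel κ (y i) z)| ∂μ ≤ 1 / 3 := by
    intro s hs
    obtain ⟨t, ht, hst⟩ := Set.mem_iUnion₂.1 (hcov hs)
    have hst' : ‖w s - w t‖ < 1 / 6 := hst
    rw [← norm_sum_translateKernelL1 hκ hκs c (fun i => s * y i) y]
    have h1 : ∑ i, c i • (w (s * y i) - w (y i)) = ∑ i, c i • (w (t * y i) - w (y i)) +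
        ∑ i, c i • (w (s * y i) - w (t * y i)) := by
      rw [← Finset.sum_add_distrib]
      refine Finset.sum_congr rfl fun i _ => ?_
      rw [← smul_add]
      congr 1
      abel
    have h2 : ‖∑ i, c i • (w (s * y i) - w (t * y i))‖ ≤ 1 / 6 := by
      refine (norm_sum_le _ _).trans ?_
      have h6 : (1 / 6 : ℝ) = ∑ i, c i * (1 / 6) := by rw [← Finset.sum_mul, hc1, one_mul]
      rw [h6]
      refine Finset.sum_le_sum fun i _ => ?_
      rw [norm_smul, Real.norm_of_nonneg (hc0 i)]
      refine mul_le_mul_of_nonneg_left ?_ (hc0 i)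
      rw [hw, norm_translateKernelL1_sub, integral_abs_translateKernel_mul_sub hκ hκs,
        ← norm_translateKernelL1_sub hκ hκs]
      exact hst'.le
    rw [h1]
    refine (norm_add_le _ _).trans ?_
    linarith [hcF t ht]
  refine ⟨fun z => ∑ i, c i * translateKernel κ (y i) z,
    fun z => ∑ i, c i * (modularCharacterFun (y i) * l (z * (y i)⁻¹)), ?_, ?_, fun z => ?_, ?_, ?_,
    fun z => ?_, ?_, fun x hx => ?_⟩
  · exact continuous_finsetSum _ fun i _ => continuous_const.mul
      ((continuous_translateKernel hκ).comp (Continuous.prodMk_right (y i)))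
  · refine HasCompactSupport.intro
      (hκs.isCompact.inv.mul (Set.finite_range y).isCompact) fun z hz => ?_
    refine Finset.sum_eq_zero fun i _ => ?_
    rw [translateKernel_eq_zero fun h => hz (Set.mul_subset_mul_left (by simp) h), mul_zero]
  · exact Finset.sum_nonneg fun i _ => mul_nonneg (hc0 i)
      (mul_nonneg (modularCharacterFun_coe_pos _).le (hκ0 _))
  · fun_prop
  · refine HasCompactSupport.intro
      (hls.isCompact.mul (Set.finite_range y).isCompact) fun z hz => ?_
    refine Finset.sum_eq_zero fun i _ => ?_
    rw [image_eq_zero_of_notMem_tsupport fun h =>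
      hz ⟨z * (y i)⁻¹, h, y i, Set.mem_range_self i, by simp⟩]
    simp
  · exact Finset.sum_nonneg fun i _ => mul_nonneg (hc0 i)
      (mul_nonneg (modularCharacterFun_coe_pos _).le (hl0 _))
  · rw [integral_finsetSum]
    · simp only [integral_const_mul]
      rw [← hc1]
      refine Finset.sum_congr rfl fun i _ => ?_
      rw [← integral_const_mul, integral_modularCharacterFun_mul_comp hl hls, hl1, mul_one]
    · intro i _
      refine Integrable.const_mul (Integrable.const_mul ?_ _) _
      exact (hl.comp (continuous_mul_const _)).integrable_of_hasCompactSupport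
        (hls.comp_homeomorph (Homeomorph.mulRight (y i)⁻¹))
  · have hfs : HasCompactSupport fun z => l (x⁻¹ * z) :=
      hls.comp_homeomorph (Homeomorph.mulLeft x⁻¹)
    have hf1 : ∫ z, l (x⁻¹ * z) ∂μ = 1 := by rw [integral_mul_left_eq_self, hl1]
    have h := integral_abs_sum_translateKernel_sub_le (f := fun z => l (x⁻¹ * z)) hκ hκs hκ0 hκ1
      (by fun_prop) hfs (fun z => hl0 _) hf1 hc0 hc1 (L := K * tsupport l) (W := W) (y := y)
      (fun s hs => image_eq_zero_of_notMem_tsupport fun h => hs ⟨x, hx, x⁻¹ * s, h, by simp⟩)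
      hκW hD (fun s hs => (hW s hs x hx).le)
    norm_num at h
    simpa [mul_assoc] using h

end Reiter

/-! ### The inverse of an N-function -/

section Inverse

variable {Φ : ℝ → ℝ}

lemma IsNFunction.exists_eq (h : IsNFunction Φ) {t : ℝ} (ht : 0 < t) : ∃ q, 0 < q ∧ Φ q = t := by
  have hc : Continuous Φ := continuousOn_univ.1 (h.convex.continuousOn isOpen_univ)
  obtain ⟨R, hR⟩ := eventually_atTop.1 (h.tendsto_atTop.eventually_ge_atTop t)
  have hR1 : 0 < max R 1 := by positivity
  have h1 := (le_div_iff₀ hR1).1 (hR (max R 1) (le_max_left _ _))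
  have h2 : t ≤ Φ (max R 1) := by nlinarith [le_max_right R 1]
  obtain ⟨q, hq, rfl⟩ := intermediate_value_Icc hR1.le hc.continuousOn
    (show t ∈ Set.Icc (Φ 0) (Φ (max R 1)) from ⟨by rw [h.map_zero]; exact ht.le, h2⟩)
  refine ⟨q, lt_of_le_of_ne hq.1 ?_, rfl⟩
  rintro rfl
  simp [h.map_zero] at ht

open Classical in
/-- The inverse of an `N`-function on `(0, ∞)`, extended by `0`. -/
def IsNFunction.inv (h : IsNFunction Φ) (t : ℝ) : ℝ :=
  if ht : 0 < t then (h.exists_eq ht).choose else 0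

variable (h : IsNFunction Φ)

lemma IsNFunction.inv_pos {t : ℝ} (ht : 0 < t) : 0 < h.inv t := by
  rw [IsNFunction.inv, dif_pos ht]
  exact (h.exists_eq ht).choose_spec.1

lemma IsNFunction.map_inv {t : ℝ} (ht : 0 < t) : Φ (h.inv t) = t := by
  rw [IsNFunction.inv, dif_pos ht]
  exact (h.exists_eq ht).choose_spec.2

lemma IsNFunction.inv_of_nonpos {t : ℝ} (ht : t ≤ 0) : h.inv t = 0 := by
  rw [IsNFunction.inv, dif_neg ht.not_gt]

lemma IsNFunction.inv_nonneg (t : ℝ) : 0 ≤ h.inv t := by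
  rcases le_or_gt t 0 with ht | ht
  · rw [h.inv_of_nonpos ht]
  · exact (h.inv_pos ht).le

lemma IsNFunction.monotone_inv : Monotone h.inv := by
  intro s t hst
  rcases le_or_gt s 0 with hs | hs
  · rw [h.inv_of_nonpos hs]
    exact h.inv_nonneg t
  · by_contra! hlt
    have ht : 0 < t := hs.trans_le hst
    have h1 := h.mono (h.inv_nonneg t) hlt.le
    rw [h.map_inv hs, h.map_inv ht] at h1
    rw [le_antisymm hst h1] at hlt
    exact lt_irrefl _ hlt

/-- The function `t ↦ t / Φ⁻¹(t)`, which is `0` for `t ≤ 0` because `Φ⁻¹` is extended by `0`. -/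
def IsNFunction.divInv (t : ℝ) : ℝ := t / h.inv t

lemma IsNFunction.divInv_of_nonpos {t : ℝ} (ht : t ≤ 0) : h.divInv t = 0 := by
  rw [IsNFunction.divInv, h.inv_of_nonpos ht, div_zero]

lemma IsNFunction.divInv_nonneg (t : ℝ) : 0 ≤ h.divInv t := by
  rcases le_or_gt t 0 with ht | ht
  · rw [h.divInv_of_nonpos ht]
  · exact div_nonneg ht.le (h.inv_nonneg t)

lemma IsNFunction.inv_mul_divInv {t : ℝ} (ht : 0 < t) : h.inv t * h.divInv t = t :=
  mul_div_cancel₀ _ (h.inv_pos ht).ne'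

lemma IsNFunction.monotone_divInv : Monotone h.divInv := by
  intro s t hst
  rcases le_or_gt s 0 with hs | hs
  · rw [h.divInv_of_nonpos hs]
    exact h.divInv_nonneg t
  · have ht : 0 < t := hs.trans_le hst
    have hp := h.inv_pos hs
    have hq := h.inv_pos ht
    have h1 := h.map_mul_le (c := h.inv s / h.inv t) (by positivity)
      ((div_le_one hq).2 (h.monotone_inv hst)) (h.inv t)
    rw [div_mul_cancel₀ _ hq.ne', h.map_inv hs, h.map_inv ht, div_mul_eq_mul_div,
      le_div_iff₀ hq] at h1
    rw [IsNFunction.divInv, IsNFunction.divInv, div_le_div_iff₀ hp hq]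
    linarith

/-- Both `Φ⁻¹` and `t / Φ⁻¹(t)` are monotone and their product is `t`; hence the mixed product
exceeds the minimum. -/
lemma IsNFunction.min_le_inv_mul_divInv {s t : ℝ} (hs : 0 ≤ s) (ht : 0 ≤ t) :
    min s t ≤ h.inv s * h.divInv t := by
  have h0 : 0 ≤ h.inv s * h.divInv t := mul_nonneg (h.inv_nonneg s) (h.divInv_nonneg t)
  rcases hs.eq_or_lt with rfl | hs
  · exact (min_le_left _ _).trans h0
  rcases ht.eq_or_lt with rfl | ht
  · exact (min_le_right _ _).trans h0
  rcases le_total s t with hst | hst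
  · rw [min_eq_left hst]
    calc s = h.inv s * h.divInv s := (h.inv_mul_divInv hs).symm
      _ ≤ _ := mul_le_mul_of_nonneg_left (h.monotone_divInv hst) (h.inv_nonneg s)
  · rw [min_eq_right hst]
    calc t = h.inv t * h.divInv t := (h.inv_mul_divInv ht).symm
      _ ≤ _ := mul_le_mul_of_nonneg_right (h.monotone_inv hst) (h.divInv_nonneg t)

lemma IsNFunction.continuous_divInv : Continuous h.divInv := by
  refine continuous_iff_continuousAt.2 fun t => ?_
  rcases lt_trichotomy t 0 with ht | rfl | ht
  · refine (continuousAt_const (y := (0 : ℝ))).congr ?_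
    filter_upwards [eventually_lt_nhds ht] with s hs
    exact (h.divInv_of_nonpos hs.le).symm
  · rw [ContinuousAt, h.divInv_of_nonpos le_rfl]
    rw [Metric.tendsto_nhds_nhds]
    intro ε hε
    obtain ⟨δ, hδ, hδΦ⟩ := Metric.tendsto_nhdsWithin_nhds.1 h.tendsto_zero ε hε
    refine ⟨ε * (δ / 2), by positivity, fun s hs => ?_⟩
    rw [Real.dist_eq, sub_zero] at hs ⊢
    rw [abs_of_nonneg (h.divInv_nonneg s)]
    rcases le_or_gt s 0 with hs0 | hs0
    · rw [h.divInv_of_nonpos hs0]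
      exact hε
    rw [abs_of_pos hs0] at hs
    have hp := h.inv_pos hs0
    rcases lt_or_ge (h.inv s) δ with hlt | hge
    · have := hδΦ (x := h.inv s) hp.ne' (by rwa [Real.dist_eq, sub_zero, abs_of_pos hp])
      rw [Real.dist_eq, sub_zero, h.map_inv hs0] at this
      exact (le_abs_self _).trans_lt this
    · rw [IsNFunction.divInv, div_lt_iff₀ hp]
      refine hs.trans_le (mul_le_mul_of_nonneg_left (by linarith) hε.le)
  · -- For `s > 0` the value at `s` lies between `(s / t) divInv t` and `divInv t`.
    have hl : Tendsto (fun s => min 1 (s / t) * h.divInv t) (𝓝 t) (𝓝 (h.divInv t)) := by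
      have : Continuous fun s => min 1 (s / t) * h.divInv t := by fun_prop
      simpa [div_self ht.ne'] using this.tendsto t
    have hr : Tendsto (fun s => max 1 (s / t) * h.divInv t) (𝓝 t) (𝓝 (h.divInv t)) := by
      have : Continuous fun s => max 1 (s / t) * h.divInv t := by fun_prop
      simpa [div_self ht.ne'] using this.tendsto t
    have key : ∀ {r s : ℝ}, 0 < r → r ≤ s → h.divInv s ≤ s / r * h.divInv r := fun {r s} hr hrs => by
      have hp := h.inv_pos hr
      have h1 : s / r * h.divInv r = s / h.inv r := by
        rw [IsNFunction.divInv]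
        field_simp
      rw [h1]
      exact div_le_div_of_nonneg_left (hr.le.trans hrs) hp (h.monotone_inv hrs)
    refine tendsto_of_tendsto_of_tendsto_of_le_of_le' hl hr ?_ ?_
    · filter_upwards [eventually_gt_nhds ht] with s hs
      rcases le_total s t with hst | hst
      · have h1 := key hs hst
        rw [div_mul_eq_mul_div, le_div_iff₀ hs] at h1
        refine (mul_le_mul_of_nonneg_right (min_le_right _ _) (h.divInv_nonneg t)).trans ?_
        rw [div_mul_eq_mul_div, div_le_iff₀ ht]
        linarith
      · refine (mul_le_mul_of_nonneg_right (min_le_left _ _) (h.divInv_nonneg t)).trans ?_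
        rw [one_mul]
        exact h.monotone_divInv hst
    · filter_upwards [eventually_gt_nhds ht] with s hs
      rcases le_total s t with hst | hst
      · refine le_trans ?_ (mul_le_mul_of_nonneg_right (le_max_left _ _) (h.divInv_nonneg t))
        rw [one_mul]
        exact h.monotone_divInv hst
      · exact (key ht hst).trans
          (mul_le_mul_of_nonneg_right (le_max_right _ _) (h.divInv_nonneg t))

lemma IsNFunction.complementary_divInv_le {t : ℝ} (ht : 0 ≤ t) :
    complementary Φ (h.divInv t) ≤ t := by
  rcases ht.eq_or_lt with rfl | ht
  · rw [h.divInv_of_nonpos le_rfl, h.complementary_zero]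
  · have := h.complementary_div_le (h.inv_pos ht)
    rwa [h.map_inv ht] at this

end Inverse

/-! ### Bounded local units in `A_Φ(G)` -/

section LocalUnits

open scoped Pointwise

variable {G : Type*} [MeasurableSpace G] [Group G] [TopologicalSpace G]
  [IsTopologicalGroup G] [BorelSpace G] [LocallyCompactSpace G] [T2Space G]
  {μ : Measure G} [μ.IsHaarMeasure] [μ.Regular] {Φ : ℝ → ℝ}

lemma IsNFunction.aPhiENorm_le_mul (h : IsNFunction Φ) {f g : G → ℂ}
    (hf : f ∈ morseTransue Φ μ) (hg : g ∈ morseTransue (complementary Φ) μ) {u : C₀(G, ℂ)}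
    (hu : ∀ x, u x = conv μ f (check g) x) :
    aPhiENorm Φ μ u ≤ luxemburgNorm Φ μ f * orliczNorm (complementary Φ) μ g := by
  have hsum : ∑' n : ℕ, luxemburgNorm Φ μ (if n = 0 then f else fun _ => 0) *
      orliczNorm (complementary Φ) μ g = luxemburgNorm Φ μ f * orliczNorm (complementary Φ) μ g := by
    rw [tsum_eq_single 0 fun n hn => by simp [hn, h.luxemburgNorm_zero]]
    simp
  have hrep : Represents Φ μ u (fun n => if n = 0 then f else fun _ => 0) (fun _ => g) :=
    { mem_left := fun n => by
        split_ifs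
        · exact hf
        · exact zero_mem_morseTransue h.map_zero
      mem_right := fun _ => hg
      sum_lt_top := by
        rw [hsum]
        exact ENNReal.mul_lt_top (h.luxemburgNorm_lt_top_of_mem hf)
          (h.orliczNorm_complementary_lt_top hg)
      hasSum := fun x => by
        rw [hu]
        exact hasSum_single (f := fun n : ℕ =>
          conv μ (if n = 0 then f else fun _ => 0) (check g) x) 0 fun n hn => by simp [hn, conv] }
  exact hrep.aPhiENorm_le.trans hsum.le

lemma continuous_conv_check {f g : G → ℂ} (hf : Integrable f μ) (hg : Continuous g)
    (hgs : HasCompactSupport g) : Continuous (conv μ f (check g)) := by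
  refine continuous_iff_continuousAt.2 fun x₀ => ?_
  obtain ⟨U, hU, hU'⟩ := exists_compact_mem_nhds x₀
  have := continuousOn_integral_bilinear_of_locally_integrable_of_compact_support
    (μ := μ) (ContinuousLinearMap.mul ℝ ℂ) (f := fun x y => g (x⁻¹ * y)) (s := U)
    (k := U * tsupport g) (g := f) (hU.mul hgs.isCompact)
    (by
      refine Continuous.continuousOn ?_
      simp only [Function.uncurry_def]
      fun_prop)
    (fun x y hx hy => image_eq_zero_of_notMem_tsupport fun h => hy ⟨x, hx, x⁻¹ * y, h, by simp⟩)
    hf.integrableOn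
  have h1 : conv μ f (check g) = fun x => ∫ y, f y * g (x⁻¹ * y) ∂μ :=
    funext fun x => conv_check_eq' _ _ _
  rw [h1]
  exact (by simpa using this : ContinuousOn (fun x => ∫ y, f y * g (x⁻¹ * y) ∂μ) U).continuousAt hU'

/-- Bounded local units: `A_Φ(G)` of an amenable group contains, for each compact `K`, a function
with nonnegative real part, of norm at most `8`, whose real part is at least `1/2` on `K`. It is
`Φ⁻¹(a) * ǧ` with `g = b / Φ⁻¹(b)`, where `a` and `b` come from Reiter's condition; its value at `x`
is at least `∫ min(a(y), b(x⁻¹y)) dy`. -/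
theorem IsAmenable.exists_local_unit (hG : IsAmenable μ) (h : IsNFunction Φ) {K : Set G}
    (hK : IsCompact K) :
    ∃ u : C₀(G, ℂ), aPhiENorm Φ μ u ≤ 8 ∧ (∀ x, 0 ≤ (u x).re) ∧ ∀ x ∈ K, 1 / 2 ≤ (u x).re := by
  obtain ⟨a, b, ha, has, ha0, hb, hbs, hb0, hb1, hab⟩ :=
    hG.exists_almost_invariant_density (hK.insert 1)
  set f : G → ℂ := fun z => (h.inv (a z) : ℂ) with hf
  set g : G → ℂ := fun z => (h.divInv (b z) : ℂ) with hg
  have hai : Integrable a μ := ha.integrable_of_hasCompactSupport has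
  have hbi : Integrable b μ := hb.integrable_of_hasCompactSupport hbs
  -- Only `∫ b = 1` is known exactly; the case `x = 1` of the estimate bounds `∫ a`.
  have ha1 : ∫ z, a z ∂μ ≤ 2 := by
    have h1 := hab 1 (Set.mem_insert _ _)
    simp only [inv_one, one_mul] at h1
    have hi : Integrable (fun z => |a z - b z|) μ := (hai.sub hbi).abs
    have h2 : ∫ z, a z ∂μ ≤ ∫ z, (|a z - b z| + b z) ∂μ :=
      integral_mono hai (hi.add hbi) fun z => by
        linarith [le_abs_self (a z - b z)]
    rw [integral_add hi hbi, hb1] at h2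
    linarith
  have hfm : AEStronglyMeasurable f μ :=
    (Complex.measurable_ofReal.comp
      (h.monotone_inv.measurable.comp ha.measurable)).aestronglyMeasurable
  have hgc : Continuous g := Complex.continuous_ofReal.comp (h.continuous_divInv.comp hb)
  have hgs : HasCompactSupport g := hbs.comp_left (g := fun t => (h.divInv t : ℂ))
    (by simp [h.divInv_of_nonpos le_rfl])
  have hfM : f ∈ morseTransue Φ μ := by
    obtain ⟨C, hC⟩ := has.exists_bound_of_continuous ha
    refine mem_morseTransue_of_bounded h.map_zero (fun x y hx hxy => h.mono hx hxy) hfm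
      (s := tsupport a) has.isCompact.measure_lt_top.ne (fun x hx => ?_) (C := h.inv C) fun x => ?_
    · simp [hf, image_eq_zero_of_notMem_tsupport hx, h.inv_of_nonpos le_rfl]
    · rw [hf, Complex.norm_real, Real.norm_of_nonneg (h.inv_nonneg _)]
      exact h.monotone_inv ((le_abs_self _).trans (hC x))
  have hgM : g ∈ morseTransue (complementary Φ) μ := by
    obtain ⟨C, hC⟩ := hgs.exists_bound_of_continuous hgc
    exact mem_morseTransue_of_bounded h.complementary_zero
      (fun x y hx hxy => h.complementary_mono hx hxy) hgc.aestronglyMeasurable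
      (s := tsupport g) hgs.isCompact.measure_lt_top.ne
      (fun x hx => image_eq_zero_of_notMem_tsupport hx) hC
  have hfN : luxemburgNorm Φ μ f ≤ 2 := by
    have h1 : modular Φ μ (fun x => f x / ((2 : ℝ) : ℂ)) ≤ 1 := by
      have h2 : ∀ x, Φ ‖f x / ((2 : ℝ) : ℂ)‖ ≤ 2⁻¹ * a x := fun x => by
        rw [norm_div, Complex.norm_real, Complex.norm_real, Real.norm_of_nonneg (h.inv_nonneg _),
          Real.norm_of_nonneg (by norm_num), div_eq_inv_mul]
        refine (h.map_mul_le (by norm_num) (by norm_num) _).trans ?_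
        rcases (ha0 x).eq_or_lt with h0 | h0
        · simp [← h0, h.inv_of_nonpos le_rfl, h.map_zero]
        · rw [h.map_inv h0]
      refine (lintegral_mono fun x => ENNReal.ofReal_le_ofReal (h2 x)).trans ?_
      rw [← ofReal_integral_eq_lintegral_ofReal (hai.const_mul _)
        (Eventually.of_forall fun x => mul_nonneg (by norm_num) (ha0 x)), integral_const_mul,
        ENNReal.ofReal_le_one]
      linarith
    simpa using luxemburgNorm_le_ofReal two_pos h1
  have hgN : orliczNorm (complementary Φ) μ g ≤ 4 := by
    have h1 : modular (complementary Φ) μ g ≤ 1 := by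
      refine (lintegral_mono fun x => ENNReal.ofReal_le_ofReal (?_ : _ ≤ b x)).trans ?_
      · rw [hg, Complex.norm_real, Real.norm_of_nonneg (h.divInv_nonneg _)]
        exact h.complementary_divInv_le (hb0 x)
      · rw [← ofReal_integral_eq_lintegral_ofReal hbi (Eventually.of_forall hb0), hb1]
        simp
    refine (h.orliczNorm_complementary_le hgM.1).trans ?_
    calc 2 * (modular (complementary Φ) μ g + 1) ≤ 2 * (1 + 1) := by gcongr
      _ = 4 := by norm_num
  have hfi : Integrable f μ := by
    obtain ⟨C, hC⟩ := has.exists_bound_of_continuous ha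
    have h2 : IntegrableOn f (tsupport a) μ :=
      Measure.integrableOn_of_bounded has.isCompact.measure_lt_top.ne hfm (M := h.inv C)
        (Eventually.of_forall fun x => by
          rw [hf, Complex.norm_real, Real.norm_of_nonneg (h.inv_nonneg _)]
          exact h.monotone_inv ((le_abs_self _).trans (hC x)))
    refine (integrableOn_iff_integrable_of_support_subset fun x hx => ?_).1 h2
    by_contra hx'
    exact hx (by simp [hf, image_eq_zero_of_notMem_tsupport hx', h.inv_of_nonpos le_rfl])
  have hzero : ∀ x ∉ tsupport a * (tsupport g)⁻¹, conv μ f (check g) x = 0 := fun x hx => by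
    rw [conv_check_eq]
    refine integral_eq_zero_of_ae (Eventually.of_forall fun y => ?_)
    by_cases hy : y ∈ tsupport g
    · have hxy : x * y ∉ tsupport a := fun h' => hx ⟨x * y, h', y⁻¹, Set.inv_mem_inv.2 hy, by simp⟩
      simp [hf, image_eq_zero_of_notMem_tsupport hxy, h.inv_of_nonpos le_rfl]
    · simp [image_eq_zero_of_notMem_tsupport hy]
  let u : C₀(G, ℂ) :=
    { toFun := conv μ f (check g)
      continuous_toFun := continuous_conv_check hfi hgc hgs
      zero_at_infty' := by
        refine tendsto_const_nhds.congr' ?_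
        filter_upwards [(has.isCompact.mul hgs.isCompact.inv).compl_mem_cocompact] with x hx
        exact (hzero x hx).symm }
  have hre : ∀ x, (u x).re = ∫ y, h.inv (a (x * y)) * h.divInv (b y) ∂μ := fun x => by
    have h1 : u x = ((∫ y, h.inv (a (x * y)) * h.divInv (b y) ∂μ : ℝ) : ℂ) := by
      change conv μ f (check g) x = _
      rw [conv_check_eq, ← integral_complex_ofReal]
      simp [hf, hg]
    rw [h1, Complex.ofReal_re]
  refine ⟨u, ?_, fun x => ?_, fun x hx => ?_⟩
  · refine (h.aPhiENorm_le_mul hfM hgM fun x => rfl).trans ((mul_le_mul' hfN hgN).trans ?_)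
    norm_num
  · rw [hre]
    exact integral_nonneg fun y => mul_nonneg (h.inv_nonneg _) (h.divInv_nonneg _)
  · rw [hre]
    have h1 := hab x (Set.mem_insert_of_mem _ hx)
    rw [← integral_mul_left_eq_self _ x] at h1
    simp only [inv_mul_cancel_left] at h1
    have hi1 : Integrable (fun y => |a (x * y) - b y|) μ := ((hai.comp_mul_left x).sub hbi).abs
    have hi2 : Integrable (fun y => h.inv (a (x * y)) * h.divInv (b y)) μ := by
      have := (h.integrable_translate_mul hfM hgM x).re
      simpa [hf, hg] using this
    have h2 : ∫ y, (b y - |a (x * y) - b y|) ∂μ ≤ ∫ y, h.inv (a (x * y)) * h.divInv (b y) ∂μ := by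
      refine integral_mono (hbi.sub hi1) hi2 fun y => le_trans ?_
        (h.min_le_inv_mul_divInv (ha0 (x * y)) (hb0 y))
      refine le_min ?_ ?_
      · linarith [neg_abs_le (a (x * y) - b y)]
      · linarith [abs_nonneg (a (x * y) - b y)]
    rw [integral_sub hbi hi1, hb1] at h2
    linarith

end LocalUnits

/-! ### Divergent convolutions on noncompact amenable groups -/

section Noncompact

open scoped Pointwise

variable {G : Type*} [MeasurableSpace G] [Group G] [TopologicalSpace G]
  [IsTopologicalGroup G] [BorelSpace G] [LocallyCompactSpace G] [T2Space G]
  {μ : Measure G} [μ.IsHaarMeasure] [μ.Regular] {Φ : ℝ → ℝ}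

/-- The sum of the series `∑ 2⁻ⁿ uₙ` of functions of bounded norm with nonnegative real parts
dominates each of its terms. -/
lemma IsNFunction.exists_mem_aPhi_dominating (h : IsNFunction Φ) {u : ℕ → C₀(G, ℂ)}
    {C : ℝ≥0∞} (hC : C ≠ ∞) (hu : ∀ n, aPhiENorm Φ μ (u n) ≤ C) (hre : ∀ n x, 0 ≤ (u n x).re) :
    ∃ v ∈ APhi Φ μ, ∀ n x, (2⁻¹ : ℝ) ^ n * (u n x).re ≤ ‖v x‖ := by
  set w : ℕ → C₀(G, ℂ) := fun n => ((2⁻¹ : ℂ) ^ n) • u n with hw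
  have h2 : ‖(2⁻¹ : ℂ)‖ₑ = 2⁻¹ := by
    rw [← ofReal_norm, norm_inv, RCLike.norm_ofNat, ENNReal.ofReal_inv_of_pos two_pos]
    simp
  have hle : ∑' n, aPhiENorm Φ μ (w n) < ∞ := by
    have h1 : ∀ n, aPhiENorm Φ μ (w n) ≤ 2⁻¹ ^ n * C := fun n => by
      refine (h.aPhiENorm_smul_le _ _).trans ?_
      rw [enorm_pow, h2]
      exact mul_le_mul_right (hu n) _
    refine (ENNReal.tsum_le_tsum h1).trans_lt ?_
    rw [ENNReal.tsum_mul_right, ENNReal.tsum_geometric, ENNReal.one_sub_inv_two, inv_inv]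
    exact ENNReal.mul_lt_top (by simp) hC.lt_top
  have hs : Summable w := summable_of_tsum_enorm_lt_top
    ((ENNReal.tsum_le_tsum fun n => h.enorm_le_aPhiENorm (w n)).trans_lt hle)
  refine ⟨∑' n, w n, mem_aPhi_iff.2 ((h.aPhiENorm_le_tsum hs.hasSum).trans_lt hle), fun n x => ?_⟩
  have h3 : HasSum (fun n => (2⁻¹ : ℝ) ^ n * (u n x).re) ((∑' n, w n) x).re := by
    have h4 : ∀ n, (w n x).re = (2⁻¹ : ℝ) ^ n * (u n x).re := fun n => by
      have : w n x = (((2⁻¹ : ℝ) ^ n : ℝ) : ℂ) * u n x := by simp [hw]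
      rw [this, Complex.re_ofReal_mul]
    simpa only [h4] using Complex.hasSum_re (hasSum_apply hs.hasSum x)
  exact (le_hasSum h3 n fun m _ => mul_nonneg (by positivity) (hre m x)).trans (Complex.re_le_norm _)

/-- On a noncompact amenable group there are `U, W ∈ A_Φ(G)` such that `∫ |U(y) W(y⁻¹x)| dy = ∞` for
all `x` near the identity. They dominate `2⁻ⁿ` times local units for compact sets `Kₙ` and `Kₙ⁻¹V`, so
that the integrand is at least `4⁻⁽ⁿ⁺¹⁾` on `Kₙ`, and the measure of `Kₙ` outgrows this. -/
theorem IsAmenable.exists_not_convExists [NoncompactSpace G] (hG : IsAmenable μ)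
    (h : IsNFunction Φ) : ∃ u ∈ APhi Φ μ, ∃ v ∈ APhi Φ μ, ¬ ConvExists μ u v := by
  obtain ⟨V, hV, hV1⟩ := exists_compact_mem_nhds (1 : G)
  have hKex : ∀ n : ℕ, ∃ K : Set G, IsCompact K ∧ (n : ℝ≥0∞) * 4 ^ (n + 1) < μ K := fun n => by
    have : (n : ℝ≥0∞) * 4 ^ (n + 1) < μ Set.univ := by
      rw [measure_univ_of_isMulLeftInvariant]
      exact ENNReal.mul_lt_top (by simp) (by simp)
    obtain ⟨K, -, hK, hlt⟩ := isOpen_univ.exists_lt_isCompact this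
    exact ⟨K, hK, hlt⟩
  choose K hK hμK using hKex
  choose u hu hu0 huK using fun n => hG.exists_local_unit h (hK n)
  choose v hv hv0 hvK using fun n => hG.exists_local_unit h ((hK n).inv.mul hV)
  obtain ⟨U, hU, hUu⟩ := h.exists_mem_aPhi_dominating (by simp) hu hu0
  obtain ⟨W, hW, hWv⟩ := h.exists_mem_aPhi_dominating (by simp) hv hv0
  refine ⟨U, hU, W, hW, fun hconv => ?_⟩
  obtain ⟨x, hxV, hx⟩ : ∃ x ∈ V, Integrable (fun y => U y * W (y⁻¹ * x)) μ := by
    by_contra! hnot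
    exact (Measure.measure_pos_of_mem_nhds μ hV1).ne' (measure_mono_null hnot (ae_iff.1 hconv))
  have hge : ∀ n : ℕ, (n : ℝ≥0∞) ≤ ∫⁻ y, ‖U y * W (y⁻¹ * x)‖ₑ ∂μ := fun n => by
    have h1 : ∀ y ∈ K n, ((4 : ℝ≥0∞) ^ (n + 1))⁻¹ ≤ ‖U y * W (y⁻¹ * x)‖ₑ := fun y hy => by
      have h2 := hUu n y
      have h3 := hWv n (y⁻¹ * x)
      have h4 := huK n y hy
      have h5 := hvK n (y⁻¹ * x) (Set.mul_mem_mul (Set.inv_mem_inv.2 hy) hxV)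
      have hp : (0 : ℝ) < 2⁻¹ ^ n := by positivity
      have h6 : (2⁻¹ : ℝ) ^ n * (1 / 2) ≤ ‖U y‖ := (mul_le_mul_of_nonneg_left h4 hp.le).trans h2
      have h7 : (2⁻¹ : ℝ) ^ n * (1 / 2) ≤ ‖W (y⁻¹ * x)‖ :=
        (mul_le_mul_of_nonneg_left h5 hp.le).trans h3
      have h8 : ((4 : ℝ) ^ (n + 1))⁻¹ ≤ ‖U y * W (y⁻¹ * x)‖ := by
        rw [norm_mul]
        refine le_trans (le_of_eq ?_) (mul_le_mul h6 h7 (by positivity) (norm_nonneg _))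
        rw [show (2⁻¹ : ℝ) ^ n * (1 / 2) = 2⁻¹ ^ (n + 1) by rw [pow_succ]; norm_num, ← mul_pow,
          ← inv_pow]
        norm_num
      rw [← ofReal_norm]
      refine le_trans (le_of_eq ?_) (ENNReal.ofReal_le_ofReal h8)
      rw [ENNReal.ofReal_inv_of_pos (by positivity), ENNReal.ofReal_pow (by norm_num)]
      simp
    calc (n : ℝ≥0∞) = (n * 4 ^ (n + 1)) * (4 ^ (n + 1))⁻¹ := by
          rw [mul_assoc, ENNReal.mul_inv_cancel (by positivity) (by simp), mul_one]
      _ ≤ μ (K n) * (4 ^ (n + 1))⁻¹ := mul_le_mul_left (hμK n).le _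
      _ = ∫⁻ _ in K n, ((4 : ℝ≥0∞) ^ (n + 1))⁻¹ ∂μ := by rw [setLIntegral_const, mul_comm]
      _ ≤ ∫⁻ y in K n, ‖U y * W (y⁻¹ * x)‖ₑ ∂μ :=
          setLIntegral_mono' (hK n).measurableSet h1
      _ ≤ _ := setLIntegral_le_lintegral _ _
  obtain ⟨n, hn⟩ := ENNReal.exists_nat_gt hx.2.ne
  exact absurd (hge n) hn.not_ge

end Noncompact

end OrliczFourier

end

open OrliczFourier in
theorem corollary3p4 {G : Type*} [Group G] [TopologicalSpace G] [IsTopologicalGroup G]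
    [LocallyCompactSpace G] [T2Space G] [MeasurableSpace G] [BorelSpace G]
    (μ : Measure G) [μ.IsHaarMeasure] [μ.Regular]
    (hG : IsAmenable μ) (Φ : ℝ → ℝ) (hΦ : IsNFunction Φ) :
    ((∀ u ∈ APhi Φ μ, ∀ v ∈ APhi Φ μ, ConvExists μ u v) ↔ CompactSpace G) ∧
    (IsConvBanachAlgebra μ (APhi Φ μ) (aPhiNorm Φ μ) ↔ CompactSpace G) := by
  have hcompact : (∀ u ∈ APhi Φ μ, ∀ v ∈ APhi Φ μ, ConvExists μ u v) → CompactSpace G := fun h => by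
    by_contra hc
    have : NoncompactSpace G := not_compactSpace_iff.1 hc
    obtain ⟨u, hu, v, hv, huv⟩ := hG.exists_not_convExists hΦ
    exact huv (h u hu v hv)
  refine ⟨⟨hcompact, fun _ => hΦ.isConvBanachAlgebra_of_compactSpace.conv_exists⟩,
    fun h => hcompact h.conv_exists, fun _ => hΦ.isConvBanachAlgebra_of_compactSpace⟩
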